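/- **Setting.** Let $h$ be a probability density on $\mathbb R$ (w.r.t. Lebesgue measure $\lambda$) of a noise variable $\varepsilon$ with $E\varepsilon=0$ and $0<E\varepsilon^2<\infty$, and let $f_0$ be a probability density on $\mathbb R$. One observes $Y_j=X_j+\varepsilon_j$, $j=1,\dots,n$, where $X_1,\dots,X_n,\varepsilon_1,\dots,\varepsilon_n$ are independent, the $\varepsilon_j$ have density $h$ and the $X_j$ have a common distribution $F$ (an arbitrary probability measure on $\mathbb R$); $P_F$ denotes the corresponding probability, $P_0$ the probability when $X_j$ has density $f_0$, and $E_F$ the expectation w.r.t. the law $F*h$ of $Y$. The null hypothesis is that $X$ has density $f_0$. Fix $d\in\mathbb N$. For $k=1,\dots,d$ let $\Theta_k\subseteq\mathbb R^k$ be open with $0\in\Theta_k$, and let $\{f^{(k)}_\theta\}_{\theta\in\Theta_k}$ be a family of probability densities with $f^{(k)}_0=f_0$ a.e. The families are nested: identifying $\theta\in\mathbb R^k$ with $(\theta,0,\dots,0)\in\mathbb R^m$ for $k\le m\le d$, one has $\Theta_k\subseteq\Theta_m$ and $f^{(m)}_\theta=f^{(k)}_\theta$ a.e. for $\theta\in\Theta_k$.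 Put $q_k(y;\theta)=\int f^{(k)}_\theta(s)h(y-s)\,ds$, $dQ_\theta=q_k(\cdot;\theta)\,d\lambda$, $\dot l(y;\theta)=\frac{\nabla_\theta q_k(y;\theta)}{q_k(y;\theta)}1_{[q_k(y;\theta)>0]}$ and $I(\theta)=\int \dot l\,\dot l^{T}dQ_\theta$. For each $k\le d$ the problem is assumed regular: for $\lambda$-a.e. $y$ the map $\theta\mapsto q_k(y;\theta)$ is $C^1$ on $\Theta_k$; $|\dot l(\cdot;\theta)|\in L_2(Q_\theta)$ for all $\theta\in\Theta_k$; and $I(\theta)$ is nonsingular for all $\theta\in\Theta_k$ and continuous in $\theta$. Let $l^*(y)=\dot l(y;0)$, with coordinate functions $l_1^*,\dots,l_d^*$ when $k=d$ (by nestedness the score vector of dimension $k$ is $(l_1^*,\dots,l_k^*)$ a.e.). With $l^*$ of dimension $k$ and $L=\{E_0[l^*(Y)]^Tl^*(Y)\}^{-1}$ put $$U_k=\Bigl\{\tfrac1{\sqrt n}\sum_{j=1}^n l^*(Y_j)\Bigr\}L\Bigl\{\tfrac1{\sqrt n}\sum_{j=1}^n l^*(Y_j)\Bigr\}^T .$$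 A penalty is a function $\pi:\mathbb N\times\mathbb N\to\mathbb R$ with $\pi(1,n)<\dots<\pi(d,n)$ for all sufficiently large $n$ and $\pi(j,n)-\pi(1,n)\to\infty$ as $n\to\infty$ for $j=2,\dots,d$. The selection rule is $S=\min\{k: 1\le k\le d,\ U_k-\pi(k,n)\ge U_j-\pi(j,n)\text{ for }j=1,\dots,d\}$. The test based on $U_k$ (resp. $U_S$) at level $\alpha\in(0,1)$ rejects when the statistic exceeds the upper $\alpha$-quantile of $\chi^2_k$ (resp. $\chi^2_1$). A test is *consistent against $F$* if for every $\alpha\in(0,1)$ its rejection probability tends to $\alpha$ under $P_0$ and to $1$ under $P_F$ as $n\to\infty$; it is *inconsistent against $F$* if for no $\alpha\in(0,1)$ its rejection probability under $P_F$ tends to $1$. $F$ satisfies $\langle D1\rangle$ with the integer $K$, $1\le K\le d$, if $l_1^*,\dots,l_K^*$ are integrable w.r.t. $F*h$ and $E_Fl_1^*=\dots=E_Fl_{K-1}^*=0$, $E_Fl_K^*\ne0$. **Theorem.** Let $1\le k\le d$. 1. The test based on $U_k$ is consistent against every $F$ satisfying $\langle D1\rangle$ with some $K\le k$. 2. The test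 based on $U_k$ is inconsistent against every $F$ that satisfies $\langle D1\rangle$ with some $K>k$ and for which $E_F(l_i^*)^2<\infty$ for $i=1,\dots,k$. 3. If $\pi(j,n)=o(n)$ as $n\to\infty$ for each $j=1,\dots,d$, then the test based on $U_S$ is consistent against every $F$ satisfying $\langle D1\rangle$ with some $K$. -/

import Mathlib

open MeasureTheory ProbabilityTheory Filter Topology

namespace Deconvolution

/-- `g` is a probability density on `ℝ` with respect to Lebesgue measure. -/
structure IsDensity (g : ℝ → ℝ) : Prop where
  measurable : Measurable g
  nonneg : ∀ x, 0 ≤ g x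
  integrable : Integrable g
  integral_eq_one : ∫ x, g x = 1

/-- The distribution on `ℝ` with Lebesgue density `g`. -/
noncomputable def lawOf (g : ℝ → ℝ) : Measure ℝ :=
  volume.withDensity fun x => ENNReal.ofReal (g x)

/-- `h` is the density of a noise variable `ε` with `E ε = 0` and `0 < E ε² < ∞`. -/
structure IsNoiseDensity (h : ℝ → ℝ) : Prop extends IsDensity h where
  integrable_sq : Integrable (fun x => x ^ 2) (lawOf h)
  mean_eq_zero : ∫ x, x ∂(lawOf h) = 0
  variance_pos : 0 < ∫ x, x ^ 2 ∂(lawOf h)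

/-- The law of `Y = X + ε` when `X` has distribution `F`, `ε` has density `h`, and `X`, `ε` are
independent: the convolution `F ∗ h`. -/
noncomputable def obsLaw (h : ℝ → ℝ) (F : Measure ℝ) : Measure ℝ :=
  Measure.conv F (lawOf h)

section Score

variable {k : ℕ}

/-- The density `q(y; θ) = ∫ f_θ(s) h(y - s) ds` of `Y` under the parameter `θ`. -/
noncomputable def obsDensity (h : ℝ → ℝ) (f : EuclideanSpace ℝ (Fin k) → ℝ → ℝ)
    (θ : EuclideanSpace ℝ (Fin k)) (y : ℝ) : ℝ :=
  ∫ s, f θ s * h (y - s)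

open Classical in
/-- The score function `(∂q/∂θ)(y; θ) / q(y; θ) · 1[q(y; θ) > 0]`, a vector in `ℝᵏ`. -/
noncomputable def score (h : ℝ → ℝ) (f : EuclideanSpace ℝ (Fin k) → ℝ → ℝ)
    (θ : EuclideanSpace ℝ (Fin k)) (y : ℝ) : EuclideanSpace ℝ (Fin k) :=
  if 0 < obsDensity h f θ y then
    WithLp.toLp 2 fun i =>
      fderiv ℝ (fun θ' => obsDensity h f θ' y) θ (EuclideanSpace.single i 1) / obsDensity h f θ y
  else 0

/-- The Fisher information matrix `I(θ) = ∫ l̇ l̇ᵀ dQ_θ`. -/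
noncomputable def fisherInfo (h : ℝ → ℝ) (f : EuclideanSpace ℝ (Fin k) → ℝ → ℝ)
    (θ : EuclideanSpace ℝ (Fin k)) : Matrix (Fin k) (Fin k) ℝ :=
  Matrix.of fun i j => ∫ y, score h f θ y i * score h f θ y j ∂(lawOf (obsDensity h f θ))

/-- A regular deconvolution problem with `k`-dimensional parameter set `Θ`. -/
structure IsRegular (h : ℝ → ℝ) (Θ : Set (EuclideanSpace ℝ (Fin k)))
    (f : EuclideanSpace ℝ (Fin k) → ℝ → ℝ) : Prop where
  isOpen : IsOpen Θ
  zero_mem : (0 : EuclideanSpace ℝ (Fin k)) ∈ Θ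
  isDensity : ∀ θ ∈ Θ, IsDensity (f θ)
  contDiff : ∀ᵐ y : ℝ, ContDiffOn ℝ 1 (fun θ => obsDensity h f θ y) Θ
  memLp_score : ∀ θ ∈ Θ, MemLp (score h f θ) 2 (lawOf (obsDensity h f θ))
  fisherInfo_nonsingular : ∀ θ ∈ Θ, IsUnit (fisherInfo h f θ).det
  fisherInfo_continuous : ContinuousOn (fisherInfo h f) Θ

/-- The efficient score vector `l*` for testing `θ = 0`. -/
noncomputable def effScore (h : ℝ → ℝ) (f : EuclideanSpace ℝ (Fin k) → ℝ → ℝ) (y : ℝ) :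
    EuclideanSpace ℝ (Fin k) :=
  score h f 0 y

/-- The matrix `L = {E₀ [l*(Y)]ᵀ l*(Y)}⁻¹`. -/
noncomputable def weightMatrix (h : ℝ → ℝ) (f : EuclideanSpace ℝ (Fin k) → ℝ → ℝ) :
    Matrix (Fin k) (Fin k) ℝ :=
  (Matrix.of fun i j =>
    ∫ y, effScore h f y i * effScore h f y j ∂(lawOf (obsDensity h f 0)))⁻¹

/-- The normalized score sum `n^{-1/2} ∑ⱼ l*(Yⱼ)`. -/
noncomputable def scoreSum (h : ℝ → ℝ) (f : EuclideanSpace ℝ (Fin k) → ℝ → ℝ)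
    (n : ℕ) (Y : Fin n → ℝ) : Fin k → ℝ :=
  fun i => (1 / √(n : ℝ)) * ∑ j, effScore h f (Y j) i

/-- The score test statistic `U_k`. -/
noncomputable def scoreStat (h : ℝ → ℝ) (f : EuclideanSpace ℝ (Fin k) → ℝ → ℝ)
    (n : ℕ) (Y : Fin n → ℝ) : ℝ :=
  scoreSum h f n Y ⬝ᵥ Matrix.mulVec (weightMatrix h f) (scoreSum h f n Y)

end Score

/-- The inclusion `ℝᵏ ⊆ ℝᵐ` (for `k ≤ m`) that appends zeros. -/
noncomputable def pad (k m : ℕ) (θ : EuclideanSpace ℝ (Fin k)) : EuclideanSpace ℝ (Fin m) :=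
  WithLp.toLp 2 fun i => if hi : (i : ℕ) < k then θ ⟨i, hi⟩ else 0

/-- Nested regular models of dimensions `1, …, d` for the null density `f₀`: for `1 ≤ k ≤ d` the
`k`-dimensional family `f k`, with parameter set `Θ k ⊆ ℝᵏ`, gives a regular deconvolution problem,
its density at `θ = 0` is `f₀`, and for `k ≤ m` it is the part of the `m`-dimensional family
in which the last `m - k` parameters vanish (over the parameter set `Θ k`). -/
structure IsNestedRegularFamily (h f₀ : ℝ → ℝ) (d : ℕ)
    (Θ : (k : ℕ) → Set (EuclideanSpace ℝ (Fin k)))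
    (f : (k : ℕ) → EuclideanSpace ℝ (Fin k) → ℝ → ℝ) : Prop where
  regular : ∀ k, 1 ≤ k → k ≤ d → IsRegular h (Θ k) (f k)
  null : ∀ k, 1 ≤ k → k ≤ d → f k 0 =ᵐ[volume] f₀
  nested : ∀ k m, 1 ≤ k → k ≤ m → m ≤ d → ∀ θ ∈ Θ k,
    pad k m θ ∈ Θ m ∧ f m (pad k m θ) =ᵐ[volume] f k θ

/-- A penalty for the models of dimensions `1, …, d`. -/
structure IsPenalty (d : ℕ) (pen : ℕ → ℕ → ℝ) : Prop where
  strictMono : ∀ᶠ n in atTop, ∀ i j, 1 ≤ i → i < j → j ≤ d → pen i n < pen j n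
  tendsto : ∀ j, 2 ≤ j → j ≤ d → Tendsto (fun n => pen j n - pen 1 n) atTop atTop

/-- Condition ⟨S1⟩: `π(k, n) = o(n)` for every fixed dimension `k`. -/
def CondS1 (d : ℕ) (pen : ℕ → ℕ → ℝ) : Prop :=
  ∀ k, 1 ≤ k → k ≤ d → (fun n => pen k n) =o[atTop] fun n : ℕ => (n : ℝ)

/-- The selection rule `S`: the least maximizer of `U_k - π(k, n)` over `1 ≤ k ≤ d`. -/
noncomputable def selection (h : ℝ → ℝ) (f : (k : ℕ) → EuclideanSpace ℝ (Fin k) → ℝ → ℝ)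
    (d : ℕ) (pen : ℕ → ℕ → ℝ) (n : ℕ) (Y : Fin n → ℝ) : ℕ :=
  sInf {k | 1 ≤ k ∧ k ≤ d ∧ ∀ j, 1 ≤ j → j ≤ d →
    scoreStat h (f j) n Y - pen j n ≤ scoreStat h (f k) n Y - pen k n}

/-- The data-driven score test statistic `U_S`. -/
noncomputable def dataDrivenStat (h : ℝ → ℝ) (f : (k : ℕ) → EuclideanSpace ℝ (Fin k) → ℝ → ℝ)
    (d : ℕ) (pen : ℕ → ℕ → ℝ) (n : ℕ) (Y : Fin n → ℝ) : ℝ :=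
  scoreStat h (f (selection h f d pen n Y)) n Y

/-- Condition ⟨D1⟩ for the distribution `F` of `X`, with the index `K`. The coordinate `i : Fin d`
of `l*` is the one numbered `i + 1`. -/
def CondD1 (h : ℝ → ℝ) {d : ℕ} (f : EuclideanSpace ℝ (Fin d) → ℝ → ℝ) (F : Measure ℝ)
    (K : ℕ) : Prop :=
  1 ≤ K ∧ K ≤ d ∧
    (∀ i : Fin d, (i : ℕ) + 1 < K →
      Integrable (fun y => effScore h f y i) (obsLaw h F) ∧
        ∫ y, effScore h f y i ∂(obsLaw h F) = 0) ∧
    ∀ i : Fin d, (i : ℕ) + 1 = K →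
      Integrable (fun y => effScore h f y i) (obsLaw h F) ∧
        ∫ y, effScore h f y i ∂(obsLaw h F) ≠ 0

/-- The joint law of `(X₁, ε₁), …, (Xₙ, εₙ)`: independent pairs, in each of which `X_j` has
distribution `F`, `ε_j` has density `h`, and both are independent. -/
noncomputable def sampleMeasure (h : ℝ → ℝ) (F : Measure ℝ) (n : ℕ) : Measure (Fin n → ℝ × ℝ) :=
  Measure.pi fun _ => F.prod (lawOf h)

/-- The observations `Y_j = X_j + ε_j`. -/
def obs {n : ℕ} (ω : Fin n → ℝ × ℝ) : Fin n → ℝ :=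
  fun j => (ω j).1 + (ω j).2

/-- The probability, when `X` has distribution `F`, that the statistic `T` of `n` observations
exceeds `c`. -/
noncomputable def rejectProb (h : ℝ → ℝ) (F : Measure ℝ) (T : (n : ℕ) → (Fin n → ℝ) → ℝ) (c : ℝ)
    (n : ℕ) : ℝ :=
  (sampleMeasure h F n).real {ω | c < T n (obs ω)}

/-- The chi-squared distribution with `m` degrees of freedom: the law of the sum of the squares of
`m` independent standard normal variables. -/
noncomputable def chiSquared (m : ℕ) : Measure ℝ :=
  (Measure.pi fun _ : Fin m => gaussianReal 0 1).map fun z => ∑ i, z i ^ 2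

/-- The level-`α` critical point (upper `α`-quantile) of the chi-squared distribution. -/
noncomputable def criticalPoint (m : ℕ) (α : ℝ) : ℝ :=
  sInf {c : ℝ | chiSquared m (Set.Ioi c) ≤ ENNReal.ofReal α}

/-- The test that rejects for `T` above the critical point of `χ²_m` is consistent against `F`: for
each `α ∈ (0, 1)` it has asymptotic level `α` under the null density `f₀`, and its power under `F`
tends to `1`. -/
def IsConsistentAgainst (h f₀ : ℝ → ℝ) (T : (n : ℕ) → (Fin n → ℝ) → ℝ) (m : ℕ)
    (F : Measure ℝ) : Prop :=
  ∀ α : ℝ, 0 < α → α < 1 →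
    Tendsto (rejectProb h (lawOf f₀) T (criticalPoint m α)) atTop (𝓝 α) ∧
      Tendsto (rejectProb h F T (criticalPoint m α)) atTop (𝓝 1)

/-- The test that rejects for `T` above the critical point of `χ²_m` is inconsistent against `F`: at
no level `α ∈ (0, 1)` does its power under `F` tend to `1`. -/
def IsInconsistentAgainst (h : ℝ → ℝ) (T : (n : ℕ) → (Fin n → ℝ) → ℝ) (m : ℕ)
    (F : Measure ℝ) : Prop :=
  ∀ α : ℝ, 0 < α → α < 1 →
    ¬ Tendsto (rejectProb h F T (criticalPoint m α)) atTop (𝓝 1)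

end Deconvolution

/-! The behaviour of the statistics is governed by the mean of the score `l*` under the law of `Y`.

Under the null hypothesis this mean is zero, which is not assumed and must be derived from
regularity. Along a coordinate path `q t` of densities the Fisher information is bounded near `0`,
so the increments `Δ` of `√q` have `L²` norm of order `t`. The quotients `Δ / (t √(q 0))` are
therefore bounded in `L²` of the null law and converge a.e. to half the score, hence also in mean.
Since both densities have mass one, `∫ √(q 0) Δ = -∫ Δ² / 2`, so these means are of order `t`, and
the score is centred (`integral_score_eq_zero_of_energy_le`). The central limit theorem with
covariance `I(0)` then makes `U_k` asymptotically `χ²_k`. Each `U_j` is thus tight, while choosing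
`j ≥ 2` requires `U_j` to exceed a penalty gap that diverges; so `S = 1` with probability tending to
one.

Under ⟨D1⟩ with `K ≤ k`, Cauchy–Schwarz bounds `U_k` below by a multiple of the squared `K`-th
normalized sum, which by the strong law grows like `n` and beats every `o(n)` sequence. For `U_S`
the maximality of `S` gives `U_S ≥ U_K - π(K, n) + π(S, n)`, and the penalties are `o(n)`. If `K >
k`, the first `k` scores are centred under `F`, the sums have a Gaussian limit, and this limit
charges the neighbourhood of the origin where the test accepts. -/

namespace Deconvolution

/-! ### The chi-squared law and its critical points -/

section ChiSquared

instance (m : ℕ) : IsProbabilityMeasure (chiSquared m) := by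
  unfold chiSquared
  exact Measure.isProbabilityMeasure_map (Measurable.aemeasurable (by fun_prop))

lemma chiSquared_eq_map_stdGaussian (m : ℕ) :
    chiSquared m = (stdGaussian (EuclideanSpace ℝ (Fin m))).map fun z => ∑ i, z i ^ 2 := by
  rw [chiSquared, ← map_pi_eq_stdGaussian, Measure.map_map (by fun_prop) (by fun_prop)]
  rfl

/-- By Fubini: once the other coordinates are fixed, the first has at most two possible values, and
a Gaussian law has no atoms. For `m = 0` the law is a point mass. -/
lemma chiSquared_singleton {m : ℕ} (hm : 1 ≤ m) (c : ℝ) : chiSquared m {c} = 0 := by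
  obtain ⟨m, rfl⟩ : ∃ l, m = l + 1 := ⟨m - 1, by omega⟩
  have hms : MeasurableSet {p : ℝ × (Fin m → ℝ) | p.1 ^ 2 + ∑ i, p.2 i ^ 2 = c} :=
    measurableSet_eq_fun (by fun_prop) (by fun_prop)
  have h := measurePreserving_piFinSuccAbove (fun _ : Fin (m + 1) => gaussianReal 0 1) 0
  have : NullSingletonClass (gaussianReal 0 1) := nullSingletonClass_gaussianReal (by simp)
  rw [chiSquared, Measure.map_apply (by fun_prop) (measurableSet_singleton c)]
  have heq : (fun z : Fin (m + 1) → ℝ => ∑ i, z i ^ 2) ⁻¹' {c} =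
      (MeasurableEquiv.piFinSuccAbove (fun _ : Fin (m + 1) => ℝ) 0) ⁻¹'
        {p : ℝ × (Fin m → ℝ) | p.1 ^ 2 + ∑ i, p.2 i ^ 2 = c} := by
    ext z
    simp [Fin.sum_univ_succ, MeasurableEquiv.piFinSuccAbove, Fin.insertNthEquiv, Fin.tail]
  rw [heq, h.measure_preimage hms.nullMeasurableSet, Measure.prod_apply_symm hms]
  refine (lintegral_congr fun y => ?_).trans lintegral_zero
  refine Set.Countable.measure_zero (Set.Finite.countable ?_) _
  refine (Set.toFinite {√(c - ∑ i, y i ^ 2), -√(c - ∑ i, y i ^ 2)}).subset fun x hx => ?_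
  simp only [Set.mem_preimage, Set.mem_ofPred_eq] at hx
  have : √(c - ∑ i, y i ^ 2) ^ 2 = x ^ 2 := by
    rw [Real.sq_sqrt] <;> nlinarith [sq_nonneg x]
  rcases sq_eq_sq_iff_eq_or_eq_neg.1 this with h | h <;> simp [h]

lemma measureReal_Ioi_eq_one_sub_cdf (μ : Measure ℝ) [IsProbabilityMeasure μ] :
    (fun c => μ.real (Set.Ioi c)) = fun c => 1 - cdf μ c := by
  ext c
  rw [← Set.compl_Iic, probReal_compl_eq_one_sub measurableSet_Iic, cdf_eq_real]

lemma tendsto_chiSquared_Ioi (m : ℕ) :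
    Tendsto (fun c => (chiSquared m).real (Set.Ioi c)) atTop (𝓝 0) := by
  rw [measureReal_Ioi_eq_one_sub_cdf]
  simpa using (tendsto_cdf_atTop (chiSquared m)).const_sub 1

lemma continuous_measureReal_Ioi (μ : Measure ℝ) [IsProbabilityMeasure μ]
    (hμ : ∀ c, μ {c} = 0) : Continuous fun c => μ.real (Set.Ioi c) := by
  rw [measureReal_Ioi_eq_one_sub_cdf]
  refine continuous_const.sub (continuous_iff_continuousAt.2 fun a => ?_)
  rw [(monotone_cdf μ).continuousAt_iff_leftLim_eq_rightLim, StieltjesFunction.rightLim_eq]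
  have h2 := (cdf μ).measure_singleton a
  rw [measure_cdf, hμ, eq_comm, ENNReal.ofReal_eq_zero] at h2
  exact le_antisymm ((monotone_cdf μ).leftLim_le le_rfl) (by linarith)

/-- The tail is continuous with limits `1` and `0`, so the infimum is attained; a tail below `α`
there would persist slightly to the left. -/
lemma chiSquared_Ioi_criticalPoint {m : ℕ} (hm : 1 ≤ m) {α : ℝ} (h0 : 0 < α) (h1 : α < 1) :
    (chiSquared m).real (Set.Ioi (criticalPoint m α)) = α := by
  set g : ℝ → ℝ := fun c => (chiSquared m).real (Set.Ioi c) with hg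
  have hcont : Continuous g := continuous_measureReal_Ioi _ (chiSquared_singleton hm)
  have hA : {c : ℝ | chiSquared m (Set.Ioi c) ≤ ENNReal.ofReal α} = {c | g c ≤ α} := by
    ext c
    simp only [Set.mem_ofPred_eq, hg, measureReal_def]
    rw [ENNReal.le_ofReal_iff_toReal_le (measure_ne_top _ _) h0.le]
  have htop : Tendsto g atTop (𝓝 0) := tendsto_chiSquared_Ioi m
  have hbot : Tendsto g atBot (𝓝 1) := by
    rw [hg, measureReal_Ioi_eq_one_sub_cdf]
    simpa using (tendsto_cdf_atBot (chiSquared m)).const_sub 1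
  have hclosed : IsClosed {c | g c ≤ α} := isClosed_le hcont continuous_const
  have hne : {c | g c ≤ α}.Nonempty := (htop.eventually (ge_mem_nhds h0)).exists
  obtain ⟨b, hb⟩ := (hbot.eventually (lt_mem_nhds h1)).exists_forall_of_atBot
  have hbdd : BddBelow {c | g c ≤ α} :=
    ⟨b, fun c hc => le_of_not_ge fun hcb => absurd (hb c hcb) (not_lt.2 hc)⟩
  rw [criticalPoint, hA]
  refine le_antisymm (hclosed.csInf_mem hne hbdd) (le_of_not_gt fun hlt => ?_)
  have hev : ∀ᶠ c in 𝓝[<] (sInf {c | g c ≤ α}), g c < α :=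
    (hcont.continuousAt.eventually (gt_mem_nhds hlt)).filter_mono nhdsWithin_le_nhds
  obtain ⟨c, hc, hc'⟩ := (hev.and self_mem_nhdsWithin).exists
  exact absurd (csInf_le hbdd hc.le) (not_le.2 hc')

/-- Makes the acceptance region a neighbourhood of the origin, as inconsistency requires. At a
nonpositive point the tail would be `1`, not `α`. -/
lemma criticalPoint_pos {m : ℕ} (hm : 1 ≤ m) {α : ℝ} (h0 : 0 < α) (h1 : α < 1) :
    0 < criticalPoint m α := by
  by_contra! hle
  have h := chiSquared_Ioi_criticalPoint hm h0 h1
  have hz : chiSquared m (Set.Iic (criticalPoint m α)) = 0 := by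
    refine measure_mono_null (Set.Iic_subset_Iic.2 hle) ?_
    rw [← Set.Iio_union_right]
    refine measure_union_null ?_ (chiSquared_singleton hm 0)
    rw [chiSquared, Measure.map_apply (by fun_prop) measurableSet_Iio]
    have : (fun z : Fin m → ℝ => ∑ i, z i ^ 2) ⁻¹' Set.Iio 0 = ∅ := by
      ext z
      simpa using Finset.sum_nonneg fun i _ => sq_nonneg (z i)
    rw [this, measure_empty]
  rw [← Set.compl_Iic, probReal_compl_eq_one_sub measurableSet_Iic, measureReal_def, hz] at h
  simp at h
  linarith

end ChiSquared

/-! ### Multivariate central limit theorem -/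

section CentralLimit

variable {Ω : Type*} {mΩ : MeasurableSpace Ω} {P : Measure Ω} [IsProbabilityMeasure P] {k : ℕ}

open scoped RealInnerProductSpace in
-- Cramér–Wold: the characteristic function at `t` is that of the scalar projection `⟪t, X⟫` at `1`,
-- to which the one-dimensional theorem applies with variance `tᵀ S t`.
theorem tendsto_charFun_sum_iid {X : ℕ → Ω → EuclideanSpace ℝ (Fin k)}
    {S : Matrix (Fin k) (Fin k) ℝ} (hS : S.PosSemidef)
    (hX : MemLp (X 0) 2 P) (hmean : ∀ i, ∫ ω, X 0 ω i ∂P = 0)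
    (hcov : ∀ i j, ∫ ω, X 0 ω i * X 0 ω j ∂P = S i j) (hindep : iIndepFun X P)
    (hident : ∀ i, IdentDistrib (X i) (X 0) P P) (t : EuclideanSpace ℝ (Fin k)) :
    Tendsto (fun n : ℕ => charFun (P.map fun ω => (√n)⁻¹ • ∑ j ∈ Finset.range n, X j ω) t) atTop
      (𝓝 (charFun (multivariateGaussian 0 S) t)) := by
  have hXi : ∀ i, MemLp (fun ω => X 0 ω i) 2 P := fun i => hX.eval_piLp i
  have hinner : ∀ x : EuclideanSpace ℝ (Fin k), ⟪t, x⟫ = ∑ i, t i * x i := fun x => by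
    simp [PiLp.inner_apply, mul_comm]
  have hm : ∫ ω, ⟪t, X 0 ω⟫ ∂P = 0 := by
    simp_rw [hinner]
    rw [integral_finsetSum _ fun i _ => ((hXi i).integrable (by norm_num)).const_mul _]
    simp [integral_const_mul, hmean]
  have hL2 : MemLp (fun ω => ⟪t, X 0 ω⟫) 2 P := hX.const_inner t
  have hvar : Var[fun ω => ⟪t, X 0 ω⟫; P] = t ⬝ᵥ S.mulVec t := by
    have hint : ∀ i j, Integrable (fun ω => t i * X 0 ω i * (t j * X 0 ω j)) P := fun i j =>
      ((hXi i).const_mul (t i)).integrable_mul ((hXi j).const_mul (t j))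
    rw [variance_of_integral_eq_zero hL2.aemeasurable hm]
    simp_rw [hinner, pow_two, Finset.sum_mul_sum]
    rw [integral_finsetSum _ fun i _ => integrable_finsetSum _ fun j _ => hint i j]
    simp only [dotProduct, Matrix.mulVec]
    refine Finset.sum_congr rfl fun i _ => ?_
    rw [integral_finsetSum _ fun j _ => hint i j, Finset.mul_sum]
    refine Finset.sum_congr rfl fun j _ => ?_
    rw [← hcov, ← integral_mul_const, ← integral_const_mul]
    congr 1; ext ω; ring
  have hclt := tendstoInDistribution_inv_sqrt_mul_sum_sub (Y := id)
    (P' := gaussianReal 0 Var[fun ω => ⟪t, X 0 ω⟫; P].toNNReal)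
    (X := fun i ω => ⟪t, X i ω⟫) (P := P)
    ⟨by fun_prop, by simp⟩ hL2 (hindep.comp (fun _ x => ⟪t, x⟫) (by fun_prop))
    (fun i => (hident i).comp (u := fun x => ⟪t, x⟫) (by fun_prop))
  have h1 := ProbabilityMeasure.tendsto_iff_tendsto_charFun.1 hclt.tendsto 1
  have mX : ∀ i, AEMeasurable (X i) P := fun i => (hident i).aemeasurable_fst
  convert h1 using 2 with n
  · simp only [ProbabilityMeasure.coe_mk, hm, charFun_apply]
    rw [integral_map (by fun_prop) (by fun_prop), integral_map (by fun_prop) (by fun_prop)]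
    congr 1; ext ω
    rw [real_inner_comm, real_inner_smul_right, inner_sum]
    simp
  · simp only [ProbabilityMeasure.coe_mk, hvar, Measure.map_id]
    rw [charFun_multivariateGaussian hS, charFun_gaussianReal]
    have : 0 ≤ t ⬝ᵥ S.mulVec t := by simpa using hS.dotProduct_mulVec_nonneg t
    simp only [inner_zero_right, Real.coe_toNNReal _ this]
    simp

/-- The **central limit theorem** for independent identically distributed centred vectors. -/
theorem tendstoInDistribution_sum_iid {X : ℕ → Ω → EuclideanSpace ℝ (Fin k)}
    {S : Matrix (Fin k) (Fin k) ℝ} (hS : S.PosSemidef)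
    (hX : MemLp (X 0) 2 P) (hmean : ∀ i, ∫ ω, X 0 ω i ∂P = 0)
    (hcov : ∀ i j, ∫ ω, X 0 ω i * X 0 ω j ∂P = S i j) (hindep : iIndepFun X P)
    (hident : ∀ i, IdentDistrib (X i) (X 0) P P) :
    TendstoInDistribution (fun (n : ℕ) ω => (√n)⁻¹ • ∑ j ∈ Finset.range n, X j ω) atTop id
      (fun _ => P) (multivariateGaussian 0 S) where
  forall_aemeasurable n := by
    have mX : ∀ i, AEMeasurable (X i) P := fun i => (hident i).aemeasurable_fst
    fun_prop
  tendsto := by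
    refine ProbabilityMeasure.tendsto_iff_tendsto_charFun.2 fun t => ?_
    simpa using tendsto_charFun_sum_iid hS hX hmean hcov hindep hident t

end CentralLimit

/-! ### Quadratic forms of Gaussian vectors -/

section QuadraticForm

variable {k : ℕ} {S : Matrix (Fin k) (Fin k) ℝ}

/-- The quadratic form on `ℝᵏ` with matrix `W`. -/
noncomputable def quadForm (W : Matrix (Fin k) (Fin k) ℝ) (x : EuclideanSpace ℝ (Fin k)) : ℝ :=
  x ⬝ᵥ W.mulVec x

lemma continuous_quadForm (W : Matrix (Fin k) (Fin k) ℝ) : Continuous (quadForm W) := by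
  unfold quadForm
  simp only [dotProduct, Matrix.mulVec]
  fun_prop

lemma quadForm_nonneg {W : Matrix (Fin k) (Fin k) ℝ} (hW : W.PosSemidef)
    (x : EuclideanSpace ℝ (Fin k)) : 0 ≤ quadForm W x := by
  simpa [quadForm] using hW.dotProduct_mulVec_nonneg x

/-- Cauchy–Schwarz for the inner product with matrix `S⁻¹`, applied to `x` and `v = S eᵢ`: their
product is `x i` and the square of `v` is `S i i`. The scalar `t` minimizes the form at `x - t v`.
-/
lemma sq_le_mul_quadForm_inv (hS : S.PosDef) (i : Fin k) (x : EuclideanSpace ℝ (Fin k)) :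
    x i ^ 2 ≤ S i i * quadForm S⁻¹ x := by
  have hii : 0 < S i i := hS.diag_pos
  have hdet : IsUnit S.det := (Matrix.isUnit_iff_isUnit_det S).1 hS.isUnit
  set t : ℝ := x i / S i i
  set v : Fin k → ℝ := S.mulVec (Pi.single i 1)
  have hv : S⁻¹.mulVec v = Pi.single i 1 := by
    rw [Matrix.mulVec_mulVec, Matrix.nonsing_inv_mul _ hdet, Matrix.one_mulVec]
  have hsymm : v ⬝ᵥ S⁻¹.mulVec x = x i := by
    rw [Matrix.dotProduct_mulVec, ← Matrix.mulVec_transpose, Matrix.transpose_nonsing_inv,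
      show S.transpose = S from hS.1, hv]
    simp
  have hvi : v i = S i i := by simp [v]
  have h := hS.posSemidef.inv.dotProduct_mulVec_nonneg ((x : Fin k → ℝ) - t • v)
  simp only [star_trivial, Matrix.mulVec_sub, Matrix.mulVec_smul, hv, sub_dotProduct,
    dotProduct_sub, smul_dotProduct, dotProduct_smul, hsymm, smul_eq_mul, dotProduct_single,
    Pi.sub_apply, Pi.smul_apply, hvi, mul_one] at h
  have ht : t * S i i = x i := div_mul_cancel₀ _ hii.ne'
  have : t * x i ≤ quadForm S⁻¹ x := by
    unfold quadForm
    rw [ht] at h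
    linarith
  calc x i ^ 2 = S i i * (t * x i) := by rw [← mul_assoc, mul_comm (S i i), ht, pow_two]
    _ ≤ _ := by gcongr

/-- The Gaussian is the image of a standard one under `R = √S`, and `R S⁻¹ R = 1`. -/
lemma map_quadForm_multivariateGaussian (hS : S.PosDef) :
    (multivariateGaussian 0 S).map (quadForm S⁻¹) = chiSquared k := by
  rw [chiSquared_eq_map_stdGaussian, multivariateGaussian,
    Measure.map_map (continuous_quadForm _).measurable (by fun_prop)]
  congr 1
  ext z
  open scoped MatrixOrder in
  have hsq : CFC.sqrt S * CFC.sqrt S = S := CFC.sqrt_mul_sqrt_self _ hS.posSemidef.nonneg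
  open scoped MatrixOrder in
  have hsa : (CFC.sqrt S).transpose = CFC.sqrt S :=
    (CFC.sqrt_nonneg S).isSelfAdjoint
  have hdet : IsUnit S.det := (Matrix.isUnit_iff_isUnit_det S).1 hS.isUnit
  set R := CFC.sqrt S
  have hR : IsUnit R.det := by
    rw [← hsq, Matrix.det_mul] at hdet
    exact isUnit_of_mul_isUnit_left hdet
  have hRR : R * (S⁻¹ * R) = 1 := by
    rw [← hsq, Matrix.mul_inv_rev, Matrix.mul_assoc, Matrix.nonsing_inv_mul _ hR, Matrix.mul_one,
      Matrix.mul_nonsing_inv _ hR]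
  simp only [Function.comp_apply, quadForm, zero_add, Matrix.ofLp_toEuclideanCLM]
  rw [Matrix.mulVec_mulVec, ← hsa, Matrix.mulVec_transpose, ← Matrix.dotProduct_mulVec,
    Matrix.mulVec_mulVec, hsa, hRR, Matrix.one_mulVec]
  simp [dotProduct, pow_two]

/-- The set is pulled back to the standard Gaussian, which charges every nonempty open set; a
singular `S` is therefore allowed. -/
lemma multivariateGaussian_setOf_lt_pos (S : Matrix (Fin k) (Fin k) ℝ)
    {g : EuclideanSpace ℝ (Fin k) → ℝ} (hg : Continuous g) (h0 : g 0 = 0) {c : ℝ} (hc : 0 < c) :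
    0 < multivariateGaussian 0 S {x | g x < c} := by
  have hopen : IsOpen {x | g x < c} := isOpen_lt hg continuous_const
  have : (gaussianReal 0 1).IsOpenPosMeasure :=
    (gaussianReal_absolutelyContinuous' 0 one_ne_zero).isOpenPosMeasure
  rw [multivariateGaussian, ← map_pi_eq_stdGaussian,
    Measure.map_map (by fun_prop) (by fun_prop), Measure.map_apply (by fun_prop)
    hopen.measurableSet]
  refine (hopen.preimage ?_).measure_pos _ ⟨0, ?_⟩
  · fun_prop
  · simp [h0, hc]

end QuadraticForm

/-- Continuity from below along the increasing events "in `s n` for all `n ≥ N`". -/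
lemma tendsto_measureReal_one_of_ae_eventually {Ω : Type*} {mΩ : MeasurableSpace Ω}
    {P : Measure Ω} [IsProbabilityMeasure P] {s : ℕ → Set Ω}
    (hs : ∀ᵐ ω ∂P, ∀ᶠ n in atTop, ω ∈ s n) : Tendsto (fun n => P.real (s n)) atTop (𝓝 1) := by
  have hmono : Monotone fun N => {ω | ∀ n, N ≤ n → ω ∈ s n} :=
    fun N N' hN ω hω n hn => hω n (hN.trans hn)
  have h1 : P (⋃ N, {ω | ∀ n, N ≤ n → ω ∈ s n}) = 1 := by
    rw [← measure_univ (μ := P)]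
    refine measure_congr (eventuallyEq_univ.2 ?_)
    filter_upwards [hs] with ω hω
    obtain ⟨N, hN⟩ := eventually_atTop.1 hω
    exact Set.mem_iUnion.2 ⟨N, hN⟩
  have h2 := (ENNReal.tendsto_toReal (measure_ne_top _ _)).comp
    (tendsto_measure_iUnion_atTop (μ := P) hmono)
  rw [h1, ENNReal.toReal_one] at h2
  exact tendsto_of_tendsto_of_tendsto_of_le_of_le h2 tendsto_const_nhds
    (fun N => measureReal_mono fun ω hω => hω N le_rfl) fun n => measureReal_le_one

/-! ### Limit theorems for the normalized sums -/

section Sampling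

variable {h : ℝ → ℝ} {F : Measure ℝ} {k : ℕ}

/-- The law of an infinite sequence of independent pairs `(X_j, ε_j)`. -/
noncomputable def seqMeasure (h : ℝ → ℝ) (F : Measure ℝ) : Measure (ℕ → ℝ × ℝ) :=
  Measure.infinitePi fun _ => F.prod (lawOf h)

/-- The normalized sum `n^{-1/2} ∑ⱼ ℓ(Yⱼ)`. -/
noncomputable def normSum (ℓ : ℝ → EuclideanSpace ℝ (Fin k)) (n : ℕ) (Y : Fin n → ℝ) :
    EuclideanSpace ℝ (Fin k) :=
  (√n)⁻¹ • ∑ j, ℓ (Y j)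

lemma scoreStat_eq_quadForm (h : ℝ → ℝ) (f : EuclideanSpace ℝ (Fin k) → ℝ → ℝ) (n : ℕ)
    (Y : Fin n → ℝ) :
    scoreStat h f n Y = quadForm (weightMatrix h f) (normSum (effScore h f) n Y) := by
  have : scoreSum h f n Y = (normSum (effScore h f) n Y).ofLp := by
    ext i
    simp [scoreSum, normSum]
  rw [scoreStat, quadForm, this]

variable [IsProbabilityMeasure F] [IsProbabilityMeasure (lawOf h)]

instance : IsProbabilityMeasure (sampleMeasure h F n) := by
  unfold sampleMeasure; infer_instance

instance : IsProbabilityMeasure (seqMeasure h F) := by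
  unfold seqMeasure; infer_instance

instance : IsProbabilityMeasure (obsLaw h F) := by
  unfold obsLaw; infer_instance

/-- Puts the samples of all sizes on one probability space, where the strong law and the central
limit theorem make sense. -/
lemma measurePreserving_seqMeasure (n : ℕ) :
    MeasurePreserving (fun (ω : ℕ → ℝ × ℝ) (j : Fin n) => ω j) (seqMeasure h F)
      (sampleMeasure h F n) := by
  refine ⟨by fun_prop, ?_⟩
  rw [seqMeasure, sampleMeasure, Measure.map_infinitePi_infinitePi_of_inj Fin.val_injective,
    Measure.infinitePi_eq_pi]

lemma measurePreserving_obs_eval (j : ℕ) :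
    MeasurePreserving (fun ω : ℕ → ℝ × ℝ => (ω j).1 + (ω j).2) (seqMeasure h F)
      (obsLaw h F) := by
  have h1 : MeasurePreserving (fun p : ℝ × ℝ => p.1 + p.2) (F.prod (lawOf h)) (obsLaw h F) :=
    ⟨by fun_prop, rfl⟩
  exact h1.comp (measurePreserving_eval_infinitePi (fun _ : ℕ => F.prod (lawOf h)) j)

lemma measurePreserving_obs_sample {n : ℕ} (j : Fin n) :
    MeasurePreserving (fun ω : Fin n → ℝ × ℝ => obs ω j) (sampleMeasure h F n)
      (obsLaw h F) := by
  have h1 : MeasurePreserving (fun p : ℝ × ℝ => p.1 + p.2) (F.prod (lawOf h)) (obsLaw h F) :=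
    ⟨by fun_prop, rfl⟩
  exact h1.comp (measurePreserving_eval (fun _ : Fin n => F.prod (lawOf h)) j)

variable {ℓ : ℝ → EuclideanSpace ℝ (Fin k)}

lemma aemeasurable_normSum (hℓ : AEMeasurable ℓ (obsLaw h F)) (n : ℕ) :
    AEMeasurable (fun ω => normSum ℓ n (obs ω)) (sampleMeasure h F n) := by
  unfold normSum
  have hj : ∀ j, AEMeasurable (fun ω => ℓ (obs ω j)) (sampleMeasure h F n) := fun j =>
    hℓ.comp_quasiMeasurePreserving (measurePreserving_obs_sample j).quasiMeasurePreserving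
  exact (Finset.aemeasurable_fun_sum (f := fun j ω => ℓ (obs ω j)) Finset.univ
    fun j _ => hj j).const_smul (√(n : ℝ))⁻¹

lemma rejectProb_eq_seqMeasure {T : (n : ℕ) → (Fin n → ℝ) → ℝ} (c : ℝ) (n : ℕ)
    (hT : AEMeasurable (fun ω => T n (obs ω)) (sampleMeasure h F n)) :
    rejectProb h F T c n =
      (seqMeasure h F).real {ω | c < T n (obs fun j : Fin n => ω j)} := by
  rw [rejectProb, measureReal_def, measureReal_def]
  congr 1
  exact ((measurePreserving_seqMeasure n).measure_preimage
    (nullMeasurableSet_lt aemeasurable_const hT)).symm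

lemma iIndepFun_obs (hℓ : AEMeasurable ℓ (obsLaw h F)) :
    iIndepFun (fun (j : ℕ) (ω : ℕ → ℝ × ℝ) => ℓ ((ω j).1 + (ω j).2)) (seqMeasure h F) := by
  have h1 : iIndepFun (fun (j : ℕ) (ω : ℕ → ℝ × ℝ) => (ω j).1 + (ω j).2) (seqMeasure h F) :=
    iIndepFun_infinitePi (X := fun _ (p : ℝ × ℝ) => p.1 + p.2) (by fun_prop)
  refine h1.comp₀ (fun _ => ℓ) (fun j => by fun_prop) fun j => ?_
  rwa [(measurePreserving_obs_eval j).map_eq]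

lemma identDistrib_obs (hℓ : AEMeasurable ℓ (obsLaw h F)) (j : ℕ) :
    IdentDistrib (fun ω : ℕ → ℝ × ℝ => ℓ ((ω j).1 + (ω j).2))
      (fun ω : ℕ → ℝ × ℝ => ℓ ((ω 0).1 + (ω 0).2)) (seqMeasure h F) (seqMeasure h F) := by
  have h1 : IdentDistrib (fun ω : ℕ → ℝ × ℝ => (ω j).1 + (ω j).2)
      (fun ω : ℕ → ℝ × ℝ => (ω 0).1 + (ω 0).2) (seqMeasure h F) (seqMeasure h F) :=
    ⟨by fun_prop, by fun_prop, by
      rw [(measurePreserving_obs_eval j).map_eq, (measurePreserving_obs_eval 0).map_eq]⟩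
  refine h1.comp_of_aemeasurable ?_
  rwa [(measurePreserving_obs_eval j).map_eq]

/-- If `ℓ(Y)` is centred with covariance matrix `S`, then its normalized sums converge in law to
`N(0, S)`. -/
theorem tendstoInDistribution_normSum {S : Matrix (Fin k) (Fin k) ℝ} (hS : S.PosSemidef)
    (hℓ : MemLp ℓ 2 (obsLaw h F)) (hmean : ∀ i, ∫ y, ℓ y i ∂(obsLaw h F) = 0)
    (hcov : ∀ i j, ∫ y, ℓ y i * ℓ y j ∂(obsLaw h F) = S i j) :
    TendstoInDistribution
      (fun (n : ℕ) (ω : ℕ → ℝ × ℝ) => normSum ℓ n (obs fun j : Fin n => ω j)) atTop id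
      (fun _ => seqMeasure h F) (multivariateGaussian 0 S) := by
  have hmp := measurePreserving_obs_eval (h := h) (F := F) 0
  have hm := hℓ.aestronglyMeasurable
  have hsum : ∀ (n : ℕ) (ω : ℕ → ℝ × ℝ), normSum ℓ n (obs fun j : Fin n => ω j) =
      (√n)⁻¹ • ∑ j ∈ Finset.range n, ℓ ((ω j).1 + (ω j).2) := fun n ω => by
    rw [normSum, ← Fin.sum_univ_eq_sum_range]
    rfl
  simp_rw [hsum]
  have key : ∀ g : ℝ → ℝ, AEStronglyMeasurable g (obsLaw h F) →
      ∫ ω, g ((ω 0).1 + (ω 0).2) ∂(seqMeasure h F) = ∫ y, g y ∂(obsLaw h F) := fun g hg => by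
    rw [← hmp.map_eq, integral_map hmp.measurable.aemeasurable (by rwa [hmp.map_eq])]
  have hmi : ∀ i, AEStronglyMeasurable (fun y => ℓ y i) (obsLaw h F) := fun i =>
    (hℓ.eval_piLp i).aestronglyMeasurable
  refine tendstoInDistribution_sum_iid (X := fun (j : ℕ) (ω : ℕ → ℝ × ℝ) =>
    ℓ ((ω j).1 + (ω j).2)) hS (hℓ.comp_measurePreserving hmp) (fun i => ?_) (fun i j => ?_)
    (iIndepFun_obs hm.aemeasurable) (identDistrib_obs hm.aemeasurable)
  · rw [key (fun y => ℓ y i) (hmi i), hmean]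
  · rw [key (fun y => ℓ y i * ℓ y j) ((hmi i).mul (hmi j)), hcov]

/-- The statistic with the weight matrix `S⁻¹` is asymptotically chi-squared if `ℓ(Y)` is centred
with nonsingular covariance matrix `S`. -/
theorem tendsto_rejectProb_chiSquared (hk : 1 ≤ k) {S : Matrix (Fin k) (Fin k) ℝ} (hS : S.PosDef)
    (hℓ : MemLp ℓ 2 (obsLaw h F)) (hmean : ∀ i, ∫ y, ℓ y i ∂(obsLaw h F) = 0)
    (hcov : ∀ i j, ∫ y, ℓ y i * ℓ y j ∂(obsLaw h F) = S i j) (c : ℝ) :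
    Tendsto (rejectProb h F (fun n Y => quadForm S⁻¹ (normSum ℓ n Y)) c) atTop
      (𝓝 ((chiSquared k).real (Set.Ioi c))) := by
  have hq := (continuous_quadForm S⁻¹)
  have hD := (tendstoInDistribution_normSum hS.posSemidef hℓ hmean hcov).continuous_comp hq
  have h1 := ProbabilityMeasure.tendsto_measure_of_null_frontier_of_tendsto' hD.tendsto
    (E := Set.Ioi c) (by
      simpa [map_quadForm_multivariateGaussian hS, frontier_Ioi] using chiSquared_singleton hk c)
  have hm := aemeasurable_normSum hℓ.aestronglyMeasurable.aemeasurable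
  simp only [ProbabilityMeasure.coe_mk, Function.comp_id, map_quadForm_multivariateGaussian hS]
    at h1
  have h2 := (ENNReal.tendsto_toReal (measure_ne_top _ _)).comp h1
  refine h2.congr fun n => ?_
  rw [rejectProb_eq_seqMeasure c n (hq.measurable.comp_aemeasurable (hm n)), Function.comp_apply,
    Measure.map_apply_of_aemeasurable (hD.forall_aemeasurable n) measurableSet_Ioi]
  rfl

/-- If `ℓ(Y)` is centred and square integrable, then the power of a test based on a quadratic form
in the normalized sums of `ℓ` stays away from `1` along a subsequence. -/
theorem not_tendsto_rejectProb_one {S : Matrix (Fin k) (Fin k) ℝ} (hS : S.PosSemidef)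
    (hℓ : MemLp ℓ 2 (obsLaw h F)) (hmean : ∀ i, ∫ y, ℓ y i ∂(obsLaw h F) = 0)
    (hcov : ∀ i j, ∫ y, ℓ y i * ℓ y j ∂(obsLaw h F) = S i j) (W : Matrix (Fin k) (Fin k) ℝ)
    {c : ℝ} (hc : 0 < c) :
    ¬ Tendsto (rejectProb h F (fun n Y => quadForm W (normSum ℓ n Y)) c) atTop (𝓝 1) := by
  intro hlim
  have hq := (continuous_quadForm W)
  have hD := (tendstoInDistribution_normSum hS hℓ hmean hcov)
  have hopen : IsOpen {x | quadForm W x < c} := isOpen_lt hq continuous_const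
  have h1 := ProbabilityMeasure.le_liminf_measure_open_of_tendsto hD.tendsto hopen
  have hm := aemeasurable_normSum hℓ.aestronglyMeasurable.aemeasurable
  have hpos := multivariateGaussian_setOf_lt_pos S hq (by simp [quadForm]) hc
  simp only [ProbabilityMeasure.coe_mk, Measure.map_id] at h1
  -- The open set lies in the acceptance region, whose probability would vanish, contradicting the
  -- portmanteau bound `h1`.
  have h0 : Tendsto (fun n => (seqMeasure h F).map
      (fun ω => normSum ℓ n (obs fun j : Fin n => ω j)) {x | quadForm W x < c}) atTop (𝓝 0) := by
    have h2 : Tendsto (fun n => ENNReal.ofReal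
        (1 - rejectProb h F (fun n Y => quadForm W (normSum ℓ n Y)) c n)) atTop (𝓝 0) := by
      simpa using ENNReal.tendsto_ofReal (hlim.const_sub 1)
    refine tendsto_of_tendsto_of_tendsto_of_le_of_le tendsto_const_nhds h2
      (fun _ => zero_le) fun n => ?_
    have hmn : NullMeasurableSet {ω | c < quadForm W (normSum ℓ n (obs fun j : Fin n => ω j))}
        (seqMeasure h F) :=
      nullMeasurableSet_lt aemeasurable_const
        (hq.measurable.comp_aemeasurable (hD.forall_aemeasurable n))
    dsimp only
    rw [rejectProb_eq_seqMeasure c n (hq.measurable.comp_aemeasurable (hm n)),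
      Measure.map_apply_of_aemeasurable (hD.forall_aemeasurable n) hopen.measurableSet,
      ← probReal_compl_eq_one_sub₀ hmn, ofReal_measureReal]
    exact measure_mono fun ω (hω : quadForm W _ < c) => not_lt.2 hω.le
  rw [h0.liminf_eq] at h1
  exact absurd h1 (not_le.2 hpos)

/-- If `ℓᵢ(Y)` has a nonzero mean, then the statistic with the weight matrix `S⁻¹` tends to infinity
faster than every sequence that is `o(n)`. -/
theorem tendsto_measure_gt_of_mean_ne_zero {S : Matrix (Fin k) (Fin k) ℝ} (hS : S.PosDef)
    (hℓ : AEMeasurable ℓ (obsLaw h F)) (i : Fin k) (hint : Integrable (fun y => ℓ y i) (obsLaw h F))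
    (hmean : ∫ y, ℓ y i ∂(obsLaw h F) ≠ 0) {M : ℕ → ℝ} (hM : M =o[atTop] fun n : ℕ => (n : ℝ)) :
    Tendsto (fun n => (sampleMeasure h F n).real
      {ω | M n < quadForm S⁻¹ (normSum ℓ n (obs ω))}) atTop (𝓝 1) := by
  have hq := (continuous_quadForm S⁻¹)
  have hmp := measurePreserving_obs_eval (h := h) (F := F) 0
  have hrej : ∀ n, (sampleMeasure h F n).real {ω | M n < quadForm S⁻¹ (normSum ℓ n (obs ω))} =
      (seqMeasure h F).real
        {ω | M n < quadForm S⁻¹ (normSum ℓ n (obs fun j : Fin n => ω j))} := fun n =>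
    rejectProb_eq_seqMeasure (T := fun n Y => quadForm S⁻¹ (normSum ℓ n Y)) (M n) n
      (hq.measurable.comp_aemeasurable (aemeasurable_normSum hℓ n))
  simp_rw [hrej]
  refine tendsto_measureReal_one_of_ae_eventually ?_
  set m := ∫ y, ℓ y i ∂(obsLaw h F)
  have hlln := strong_law_ae_real (μ := seqMeasure h F)
    (fun (j : ℕ) (ω : ℕ → ℝ × ℝ) => ℓ ((ω j).1 + (ω j).2) i)
    (hmp.integrable_comp_of_integrable hint)
    (fun j j' hjj => ((iIndepFun_obs hℓ).indepFun hjj).comp (φ := fun x : EuclideanSpace ℝ (Fin k) => x i)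
      (ψ := fun x : EuclideanSpace ℝ (Fin k) => x i) (by fun_prop) (by fun_prop))
    (fun j => (identDistrib_obs hℓ j).comp (u := fun x : EuclideanSpace ℝ (Fin k) => x i) (by fun_prop))
  have hm0 : ∫ ω, ℓ ((ω 0).1 + (ω 0).2) i ∂(seqMeasure h F) = m := by
    rw [← integral_map (φ := fun ω : ℕ → ℝ × ℝ => (ω 0).1 + (ω 0).2)
      hmp.measurable.aemeasurable (f := fun y => ℓ y i)
      (by rw [hmp.map_eq]; exact hint.aestronglyMeasurable), hmp.map_eq]
  rw [hm0] at hlln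
  have hii : 0 < S i i := hS.diag_pos
  filter_upwards [hlln] with ω hω
  -- After division by `n` the claim compares a null sequence with the squared sample mean, whose
  -- limit `m ^ 2` is positive.
  have h1 : Tendsto (fun n : ℕ => S i i * (M n / n)) atTop (𝓝 0) := by
    simpa using hM.tendsto_div_nhds_zero.const_mul (S i i)
  have h2 := hω.pow 2
  have h3 := h1.eventually_lt h2 (by positivity)
  filter_upwards [h3, eventually_gt_atTop 0] with n hn hn0
  have hn0' : (0 : ℝ) < n := by exact_mod_cast hn0
  have hsum : normSum ℓ n (obs fun j : Fin n => ω j) i =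
      √n * ((∑ j ∈ Finset.range n, ℓ ((ω j).1 + (ω j).2) i) / n) := by
    rw [← Fin.sum_univ_eq_sum_range (fun j => ℓ ((ω j).1 + (ω j).2) i)]
    have : (√n)⁻¹ = √n / n := by
      rw [Real.sqrt_div_self', one_div]
    simp only [normSum, obs, PiLp.smul_apply, WithLp.ofLp_sum, Finset.sum_apply, smul_eq_mul, this]
    ring
  have h4 := sq_le_mul_quadForm_inv hS i (normSum ℓ n (obs fun j : Fin n => ω j))
  rw [hsum, mul_pow, Real.sq_sqrt hn0'.le] at h4
  have h5 : S i i * M n < n * ((∑ j ∈ Finset.range n, ℓ ((ω j).1 + (ω j).2) i) / n) ^ 2 := by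
    calc S i i * M n = n * (S i i * (M n / n)) := by field_simp
      _ < _ := by gcongr
  exact lt_of_mul_lt_mul_left (h5.trans_le h4) hii.le

end Sampling

/-! ### Laws with a Lebesgue density -/

section Densities

lemma isProbabilityMeasure_lawOf {g : ℝ → ℝ} (hg : IsDensity g) :
    IsProbabilityMeasure (lawOf g) := by
  refine ⟨?_⟩
  rw [lawOf, withDensity_apply _ MeasurableSet.univ, setLIntegral_univ,
    ← ofReal_integral_eq_lintegral_ofReal hg.integrable (Eventually.of_forall hg.nonneg),
    hg.integral_eq_one, ENNReal.ofReal_one]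

lemma lawOf_congr {g g' : ℝ → ℝ} (h : g =ᵐ[volume] g') : lawOf g = lawOf g' :=
  withDensity_congr_ae (h.mono fun y hy => by simp [hy])

lemma lawOf_absolutelyContinuous (g : ℝ → ℝ) : lawOf g ≪ volume :=
  withDensity_absolutelyContinuous _ _

lemma integral_lawOf {g : ℝ → ℝ} (hg : Measurable g) (h0 : ∀ y, 0 ≤ g y) (φ : ℝ → ℝ) :
    ∫ y, φ y ∂(lawOf g) = ∫ y, g y * φ y := by
  rw [lawOf, integral_withDensity_eq_integral_toReal_smul (by fun_prop) (by simp)]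
  simp [ENNReal.toReal_ofReal (h0 _)]

lemma ae_pos_lawOf {g : ℝ → ℝ} (hg : Measurable g) : ∀ᵐ y ∂(lawOf g), 0 < g y := by
  rw [lawOf, ae_withDensity_iff (by fun_prop)]
  exact Eventually.of_forall fun y hy => by simpa using hy

end Densities

/-! ### Hellinger distance along a smooth path -/

section Hellinger

/-- The variance of `g` about its average `c` over the interval is nonnegative. -/
lemma sq_intervalIntegral_le {g : ℝ → ℝ} (hg : Continuous g) {t : ℝ} (ht : 0 ≤ t) :
    (∫ u in (0 : ℝ)..t, g u) ^ 2 ≤ t * ∫ u in (0 : ℝ)..t, g u ^ 2 := by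
  rcases ht.eq_or_lt with rfl | ht'
  · simp
  set c := (∫ u in (0 : ℝ)..t, g u) / t
  have hc : ∫ u in (0 : ℝ)..t, g u = c * t := (div_mul_cancel₀ _ ht'.ne').symm
  have h0 : 0 ≤ ∫ u in (0 : ℝ)..t, (g u - c) ^ 2 :=
    intervalIntegral.integral_nonneg ht fun u _ => sq_nonneg _
  have h1 : ∫ u in (0 : ℝ)..t, (g u - c) ^ 2 =
      (∫ u in (0 : ℝ)..t, g u ^ 2) - c ^ 2 * t := by
    have : ∀ u, (g u - c) ^ 2 = g u ^ 2 - 2 * c * g u + c ^ 2 := fun u => by ring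
    simp_rw [this]
    rw [intervalIntegral.integral_add, intervalIntegral.integral_sub,
      intervalIntegral.integral_const_mul, hc, intervalIntegral.integral_const]
    · simp; ring
    all_goals exact Continuous.intervalIntegrable (by fun_prop) _ _
  rw [h1] at h0
  rw [hc]
  nlinarith

variable {q q' : ℝ → ℝ}

/-- The squared increment of the root of a nonnegative `C¹` function is at most a quarter of the
length times the energy `∫ q'² / q`. -/
lemma ofReal_sq_sqrt_sub_sqrt_le (hq : ∀ t, 0 ≤ q t) (hd : ∀ t, HasDerivAt q (q' t) t)
    (hc : Continuous q') {t : ℝ} (ht : 0 ≤ t) :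
    ENNReal.ofReal ((√(q t) - √(q 0)) ^ 2) ≤
      ENNReal.ofReal (t / 4) * ∫⁻ u in Set.Ioc 0 t, ENNReal.ofReal (q' u ^ 2 / q u) := by
  have hqc : Continuous q := continuous_iff_continuousAt.2 fun t => (hd t).continuousAt
  -- A zero of a nonnegative function is a minimum, so the value `0` of `q' ^ 2 / q` there loses
  -- nothing.
  have hz : ∀ u, q u = 0 → q' u = 0 := fun u hu =>
    IsLocalMin.hasDerivAt_eq_zero (Eventually.of_forall fun v => by rw [hu]; exact hq v) (hd u)
  -- The root need not be differentiable at zeros of `q`; the shift by `ε` avoids them, with a bound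
  -- free of `ε`.
  have key : ∀ ε : ℝ, 0 < ε → ENNReal.ofReal ((√(q t + ε) - √(q 0 + ε)) ^ 2) ≤
      ENNReal.ofReal (t / 4) * ∫⁻ u in Set.Ioc 0 t, ENNReal.ofReal (q' u ^ 2 / q u) := by
    intro ε hε
    have hpos : ∀ u, 0 < q u + ε := fun u => add_pos_of_nonneg_of_pos (hq u) hε
    have hsc : Continuous fun u => q' u / (2 * √(q u + ε)) :=
      hc.div (by fun_prop) fun u => by have := Real.sqrt_pos.2 (hpos u); positivity
    have hftc : ∫ u in (0 : ℝ)..t, q' u / (2 * √(q u + ε)) = √(q t + ε) - √(q 0 + ε) :=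
      intervalIntegral.integral_eq_sub_of_hasDerivAt (f := fun u => √(q u + ε))
        (fun u _ => ((hd u).add_const ε).sqrt (hpos u).ne') (hsc.intervalIntegrable _ _)
    have hle : ∀ u, (q' u / (2 * √(q u + ε))) ^ 2 ≤ q' u ^ 2 / q u / 4 := fun u => by
      rw [div_pow, mul_pow, Real.sq_sqrt (hpos u).le]
      rcases (hq u).eq_or_lt with h0 | h0
      · simp [hz u h0.symm]
      · rw [div_div]
        apply div_le_div_of_nonneg_left (sq_nonneg _) (by positivity)
        linarith
    calc ENNReal.ofReal ((√(q t + ε) - √(q 0 + ε)) ^ 2)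
        ≤ ENNReal.ofReal (t * ∫ u in (0 : ℝ)..t, (q' u / (2 * √(q u + ε))) ^ 2) := by
          rw [← hftc]
          exact ENNReal.ofReal_le_ofReal (sq_intervalIntegral_le hsc ht)
      _ = ENNReal.ofReal t *
          ∫⁻ u in Set.Ioc 0 t, ENNReal.ofReal ((q' u / (2 * √(q u + ε))) ^ 2) := by
          rw [ENNReal.ofReal_mul ht, intervalIntegral.integral_of_le ht,
            ofReal_integral_eq_lintegral_ofReal]
          · exact ((hsc.pow 2).intervalIntegrable 0 t).1
          · exact Eventually.of_forall fun u => sq_nonneg _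
      _ ≤ ENNReal.ofReal t *
          ∫⁻ u in Set.Ioc 0 t, ENNReal.ofReal (1 / 4) * ENNReal.ofReal (q' u ^ 2 / q u) := by
          gcongr with u
          rw [← ENNReal.ofReal_mul (by norm_num)]
          exact ENNReal.ofReal_le_ofReal ((hle u).trans_eq (by ring))
      _ = _ := by
          rw [lintegral_const_mul' _ _ ENNReal.ofReal_ne_top, ← mul_assoc,
            ← ENNReal.ofReal_mul ht]
          congr 2
          ring
  have hlim : Tendsto (fun ε => ENNReal.ofReal ((√(q t + ε) - √(q 0 + ε)) ^ 2)) (𝓝[>] 0)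
      (𝓝 (ENNReal.ofReal ((√(q t) - √(q 0)) ^ 2))) := by
    have : Continuous fun ε => ENNReal.ofReal ((√(q t + ε) - √(q 0 + ε)) ^ 2) :=
      ENNReal.continuous_ofReal.comp (by fun_prop)
    simpa using (this.tendsto 0).mono_left nhdsWithin_le_nhds
  exact le_of_tendsto hlim (eventually_mem_nhdsWithin.mono key)

lemma measurable_of_hasDerivAt {q q' : ℝ → ℝ → ℝ} (hm : ∀ t, Measurable (q t))
    (hd : ∀ y t, HasDerivAt (fun t => q t y) (q' t y) t) (t : ℝ) : Measurable (q' t) := by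
  have hlim : ∀ y, Tendsto (fun n : ℕ => ((n : ℝ) + 1) * (q (t + ((n : ℝ) + 1)⁻¹) y - q t y)) atTop
      (𝓝 (q' t y)) := fun y => by
    have h1 : Tendsto (fun n : ℕ => ((n : ℝ) + 1)⁻¹) atTop (𝓝[≠] 0) := by
      refine tendsto_nhdsWithin_iff.2 ⟨?_, Eventually.of_forall fun n => by
        simp only [Set.mem_compl_iff, Set.mem_singleton_iff]; positivity⟩
      simpa using tendsto_one_div_add_atTop_nhds_zero_nat (𝕜 := ℝ)
    simpa [Function.comp_def] using (hasDerivAt_iff_tendsto_slope_zero.1 (hd y t)).comp h1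
  exact measurable_of_tendsto_metrizable (fun n => ((hm _).sub (hm _)).const_mul _)
    (tendsto_pi_nhds.2 hlim)

/-- The pointwise bound is integrated in `y` and the integrals are exchanged by Tonelli; joint
measurability comes from continuity in `t`. -/
lemma lintegral_sq_sqrt_sub_sqrt_le {q q' : ℝ → ℝ → ℝ} {C : ENNReal}
    (hm : ∀ t, Measurable (q t)) (hq : ∀ t y, 0 ≤ q t y)
    (hd : ∀ y t, HasDerivAt (fun t => q t y) (q' t y) t) (hc : ∀ y, Continuous fun t => q' t y)
    (hC : ∀ t, ∫⁻ y, ENNReal.ofReal (q' t y ^ 2 / q t y) ≤ C) {t : ℝ} (ht : 0 ≤ t) :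
    ∫⁻ y, ENNReal.ofReal ((√(q t y) - √(q 0 y)) ^ 2) ≤ ENNReal.ofReal (t ^ 2 / 4) * C := by
  have hqu : Measurable (Function.uncurry q) := measurable_uncurry_of_continuous_of_measurable
    (fun y => continuous_iff_continuousAt.2 fun t => (hd y t).continuousAt) hm
  have hm' := measurable_of_hasDerivAt hm hd
  have hqu' : Measurable (Function.uncurry q') := measurable_uncurry_of_continuous_of_measurable
    hc hm'
  calc ∫⁻ y, ENNReal.ofReal ((√(q t y) - √(q 0 y)) ^ 2)
      ≤ ∫⁻ y, ENNReal.ofReal (t / 4) *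
          ∫⁻ u in Set.Ioc 0 t, ENNReal.ofReal (q' u y ^ 2 / q u y) :=
        lintegral_mono fun y => ofReal_sq_sqrt_sub_sqrt_le (fun t => hq t y) (hd y) (hc y) ht
    _ = ENNReal.ofReal (t / 4) *
          ∫⁻ u in Set.Ioc 0 t, ∫⁻ y, ENNReal.ofReal (q' u y ^ 2 / q u y) := by
        rw [lintegral_const_mul' _ _ ENNReal.ofReal_ne_top, lintegral_lintegral_swap]
        exact (((hqu'.pow_const 2).div hqu).ennreal_ofReal.comp measurable_swap).aemeasurable
    _ ≤ ENNReal.ofReal (t / 4) * ∫⁻ u in Set.Ioc 0 t, C := by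
        gcongr with u
        exact hC u
    _ = _ := by
        rw [lintegral_const, Measure.restrict_apply_univ, Real.volume_Ioc, sub_zero, mul_comm C,
          ← mul_assoc, ← ENNReal.ofReal_mul (by positivity)]
        congr 2
        ring

end Hellinger

/-! ### Convergence in mean, and centring of the score -/

section Vitali

/-- An `L²`-bounded sequence of functions on a finite measure space that converges almost everywhere
converges in mean. -/
lemma tendsto_integral_of_sq_bounded {α : Type*} {mα : MeasurableSpace α} {μ : Measure α}
    [IsFiniteMeasure μ] {r : ℕ → α → ℝ} {g : α → ℝ} {C : NNReal}
    (hr : ∀ n, AEMeasurable (r n) μ) (hC : ∀ n, ∫⁻ x, ‖r n x‖ₑ ^ 2 ∂μ ≤ C)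
    (hlim : ∀ᵐ x ∂μ, Tendsto (fun n => r n x) atTop (𝓝 (g x))) :
    Tendsto (fun n => ∫ x, r n x ∂μ) atTop (𝓝 (∫ x, g x ∂μ)) := by
  have hL2 : ∀ n, MemLp (r n) 2 μ := fun n => by
    refine ⟨(hr n).aestronglyMeasurable, ?_⟩
    rw [eLpNorm_lt_top_iff_lintegral_rpow_enorm_lt_top (by norm_num) (by norm_num)]
    simpa using (hC n).trans_lt ENNReal.coe_lt_top
  have hgm : AEMeasurable g μ := aemeasurable_of_tendsto_metrizable_ae _ hr hlim
  have hg2 : ∫⁻ x, ‖g x‖ₑ ^ 2 ∂μ ≤ C := by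
    have h1 : ∀ᵐ x ∂μ, ‖g x‖ₑ ^ 2 = liminf (fun n => ‖r n x‖ₑ ^ 2) atTop := by
      filter_upwards [hlim] with x hx
      exact ((ENNReal.continuous_pow 2).tendsto _ |>.comp hx.enorm).liminf_eq.symm
    rw [lintegral_congr_ae h1]
    refine (lintegral_liminf_le' fun n => (hr n).enorm.pow_const 2).trans ?_
    exact (liminf_le_liminf (Eventually.of_forall hC)).trans_eq (by simp)
  have hgL1 : MemLp g 1 μ := by
    have : MemLp g 2 μ := by
      refine ⟨hgm.aestronglyMeasurable, ?_⟩
      rw [eLpNorm_lt_top_iff_lintegral_rpow_enorm_lt_top (by norm_num) (by norm_num)]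
      simpa using hg2.trans_lt ENNReal.coe_lt_top
    exact this.mono_exponent (by norm_num)
  have hui : UnifIntegrable r 1 μ := by
    refine unifIntegrable_of le_rfl (by simp) (fun n => (hr n).aestronglyMeasurable)
      fun ε hε => ?_
    -- Where `|r| ≥ M` one has `M |r| ≤ r²`, so the tail integral is at most `C / M ≤ ε`. The
    -- summand `1` keeps `M` nonzero.
    set M : NNReal := C / ε.toNNReal + 1
    refine ⟨M, fun n => ?_⟩
    have hε' : 0 < ε.toNNReal := by simpa using hε
    have hM : (C : ENNReal) ≤ M * ENNReal.ofReal ε := by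
      rw [ENNReal.ofReal, ← ENNReal.coe_mul, ENNReal.coe_le_coe, add_mul,
        div_mul_cancel₀ _ hε'.ne']
      simp
    have hM0 : (M : ENNReal) ≠ 0 := by simp [M]
    rw [eLpNorm_one_eq_lintegral_enorm, ← ENNReal.mul_le_mul_iff_right hM0 ENNReal.coe_ne_top]
    refine le_trans ?_ ((hC n).trans hM)
    rw [← lintegral_const_mul' _ _ ENNReal.coe_ne_top]
    refine lintegral_mono fun x => ?_
    by_cases hx : M ≤ ‖r n x‖₊
    · rw [Set.indicator_of_mem (by exact hx), pow_two]
      gcongr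
      exact ENNReal.coe_le_coe.2 hx
    · rw [Set.indicator_of_notMem (by exact hx)]
      simp
  have h := tendsto_Lp_finite_of_tendsto_ae le_rfl (by simp)
    (fun n => (hr n).aestronglyMeasurable) hgL1 hui hlim
  refine tendsto_integral_of_L1 g hgm.aestronglyMeasurable
    (Eventually.of_forall fun n => (hL2 n).integrable (by norm_num)) ?_
  simpa [eLpNorm_one_eq_lintegral_enorm] using h

end Vitali

/-- In a `C¹` family of densities with bounded Fisher information, the score at `0` is centred. -/
theorem integral_score_eq_zero_of_energy_le {q q' : ℝ → ℝ → ℝ} {C : NNReal}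
    (hden : ∀ t, IsDensity (q t))
    (hd : ∀ y t, HasDerivAt (fun t => q t y) (q' t y) t) (hc : ∀ y, Continuous fun t => q' t y)
    (hC : ∀ t, ∫⁻ y, ENNReal.ofReal (q' t y ^ 2 / q t y) ≤ C) :
    ∫ y, q' 0 y / q 0 y ∂(lawOf (q 0)) = 0 := by
  have : IsProbabilityMeasure (lawOf (q 0)) := isProbabilityMeasure_lawOf (hden 0)
  set τ : ℕ → ℝ := fun n => ((n : ℝ) + 1)⁻¹
  have hτ : ∀ n, 0 < τ n := fun n => by positivity
  have hτ0 : Tendsto τ atTop (𝓝 0) := by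
    simpa [τ] using tendsto_one_div_add_atTop_nhds_zero_nat (𝕜 := ℝ)
  have hm := fun t => (hden t).measurable
  have hnn := fun t => (hden t).nonneg
  set Δ : ℕ → ℝ → ℝ := fun n y => √(q (τ n) y) - √(q 0 y) with hΔ
  have hΔm : ∀ n, Measurable (Δ n) := fun n => (hm _).sqrt.sub (hm _).sqrt
  have hE : ∀ n, ∫⁻ y, ENNReal.ofReal (Δ n y ^ 2) ≤ ENNReal.ofReal (τ n ^ 2 / 4) * C := fun n =>
    lintegral_sq_sqrt_sub_sqrt_le hm hnn hd hc hC (hτ n).le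
  set r : ℕ → ℝ → ℝ := fun n y => Δ n y / (τ n * √(q 0 y)) with hr
  have hrm : ∀ n, Measurable (r n) := fun n => (hΔm n).div ((hm 0).sqrt.const_mul _)
  have hrC : ∀ n, ∫⁻ y, ‖r n y‖ₑ ^ 2 ∂(lawOf (q 0)) ≤ C := fun n => by
    rw [lawOf, lintegral_withDensity_eq_lintegral_mul _ (by fun_prop) (by fun_prop)]
    calc ∫⁻ y, ENNReal.ofReal (q 0 y) * ‖r n y‖ₑ ^ 2
        ≤ ∫⁻ y, ENNReal.ofReal ((τ n ^ 2)⁻¹) * ENNReal.ofReal (Δ n y ^ 2) := by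
          refine lintegral_mono fun y => ?_
          rw [← enorm_pow, Real.enorm_of_nonneg (sq_nonneg _), ← ENNReal.ofReal_mul (hnn 0 y),
            ← ENNReal.ofReal_mul (by positivity)]
          refine ENNReal.ofReal_le_ofReal ?_
          rcases (hnn 0 y).eq_or_lt with h0 | h0
          · rw [← h0, zero_mul]; positivity
          · rw [hr]
            simp only
            rw [div_pow, mul_pow, Real.sq_sqrt h0.le]
            have := hτ n
            apply le_of_eq
            field_simp
      _ ≤ ENNReal.ofReal ((τ n ^ 2)⁻¹) * (ENNReal.ofReal (τ n ^ 2 / 4) * C) := by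
          rw [lintegral_const_mul' _ _ ENNReal.ofReal_ne_top]
          gcongr
          exact hE n
      _ = ENNReal.ofReal (1 / 4) * C := by
          rw [← mul_assoc, ← ENNReal.ofReal_mul (by positivity)]
          congr 2
          have := hτ n
          field_simp
      _ ≤ 1 * C := by
          gcongr
          rw [← ENNReal.ofReal_one]
          exact ENNReal.ofReal_le_ofReal (by norm_num)
      _ = C := one_mul _
  have hrlim : ∀ᵐ y ∂(lawOf (q 0)), Tendsto (fun n => r n y) atTop
      (𝓝 (q' 0 y / q 0 y / 2)) := by
    filter_upwards [ae_pos_lawOf (hm 0)] with y hy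
    have h1 : Tendsto τ atTop (𝓝[≠] 0) := tendsto_nhdsWithin_iff.2
      ⟨hτ0, Eventually.of_forall fun n => (hτ n).ne'⟩
    have h2 := ((hasDerivAt_iff_tendsto_slope_zero.1
      ((hd y 0).sqrt hy.ne')).comp h1).div_const (√(q 0 y))
    have h3 : q' 0 y / q 0 y / 2 = q' 0 y / (2 * √(q 0 y)) / √(q 0 y) := by
      rw [div_div, div_div, mul_assoc, Real.mul_self_sqrt hy.le, mul_comm]
    rw [h3]
    refine h2.congr fun n => ?_
    simp only [hr, hΔ, Function.comp_apply, zero_add, smul_eq_mul]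
    rw [div_mul_eq_div_div, div_eq_inv_mul (_ - _) (τ n)]
  have hlim := tendsto_integral_of_sq_bounded (fun n => (hrm n).aemeasurable) hrC hrlim
  -- From `√a (√b - √a) = ((b - a) - (√b - √a)²) / 2`; the linear term integrates to zero because
  -- both densities have mass one.
  have hint : ∀ n, ∫ y, r n y ∂(lawOf (q 0)) = -(2 * τ n)⁻¹ * ∫ y, Δ n y ^ 2 := fun n => by
    rw [integral_lawOf (hm 0) (hnn 0)]
    have hΔi : Integrable fun y => Δ n y ^ 2 := by
      refine (((hden (τ n)).integrable.add (hden 0).integrable).const_mul 2).mono'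
        ((hΔm n).pow_const 2).aestronglyMeasurable (Eventually.of_forall fun y => ?_)
      rw [Real.norm_of_nonneg (sq_nonneg _)]
      simp only [hΔ, Pi.add_apply]
      nlinarith [Real.sq_sqrt (hnn (τ n) y), Real.sq_sqrt (hnn 0 y),
        sq_nonneg (√(q (τ n) y) + √(q 0 y))]
    have h1 : ∀ y, q 0 y * r n y =
        (2 * τ n)⁻¹ * (q (τ n) y - q 0 y) - (2 * τ n)⁻¹ * Δ n y ^ 2 := fun y => by
      have h2 : q 0 y * r n y = √(q 0 y) * Δ n y / τ n := by
        rcases (hnn 0 y).eq_or_lt with h0 | h0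
        · simp [← h0]
        · have h3 : q 0 y = √(q 0 y) * √(q 0 y) := (Real.mul_self_sqrt h0.le).symm
          have h4 := Real.sqrt_pos.2 h0
          have h5 := hτ n
          simp only [hr]
          nth_rw 1 [h3]
          field_simp
      have h6 : √(q 0 y) * Δ n y = ((q (τ n) y - q 0 y) - Δ n y ^ 2) / 2 := by
        simp only [hΔ]
        nlinarith [Real.sq_sqrt (hnn (τ n) y), Real.sq_sqrt (hnn 0 y)]
      rw [h2, h6, mul_inv]
      ring
    have hqi : Integrable fun y => q (τ n) y - q 0 y :=
      (hden (τ n)).integrable.sub (hden 0).integrable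
    simp_rw [h1]
    rw [integral_sub (hqi.const_mul _)
      (hΔi.const_mul _), integral_const_mul, integral_const_mul,
      integral_sub (hden (τ n)).integrable (hden 0).integrable, (hden _).integral_eq_one,
      (hden 0).integral_eq_one]
    ring
  have hlim0 : Tendsto (fun n => ∫ y, r n y ∂(lawOf (q 0))) atTop (𝓝 0) := by
    refine squeeze_zero_norm (a := fun n => τ n / 8 * C) (fun n => ?_)
      (by simpa using (hτ0.div_const 8).mul_const (C : ℝ))
    have h1 : ∫ y, Δ n y ^ 2 ≤ τ n ^ 2 / 4 * C := by
      rw [integral_eq_lintegral_of_nonneg_ae (Eventually.of_forall fun y => sq_nonneg _)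
        ((hΔm n).pow_const 2).aestronglyMeasurable]
      refine (ENNReal.toReal_mono (by finiteness) (hE n)).trans_eq ?_
      rw [ENNReal.toReal_mul, ENNReal.toReal_ofReal (by positivity), ENNReal.coe_toReal]
    have h2 : 0 ≤ ∫ y, Δ n y ^ 2 := integral_nonneg fun y => sq_nonneg _
    have h3 := hτ n
    rw [hint, norm_mul, Real.norm_of_nonneg h2, norm_neg, Real.norm_of_nonneg (by positivity)]
    calc (2 * τ n)⁻¹ * ∫ y, Δ n y ^ 2 ≤ (2 * τ n)⁻¹ * (τ n ^ 2 / 4 * C) := by gcongr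
      _ = _ := by field_simp; ring
  have := tendsto_nhds_unique hlim hlim0
  rw [integral_div] at this
  simpa using this

/-! ### The density of the observations -/

section Mixture

variable {k : ℕ} {h : ℝ → ℝ} {f : EuclideanSpace ℝ (Fin k) → ℝ → ℝ} {θ : EuclideanSpace ℝ (Fin k)}

lemma integrable_mixture_integrand {g : ℝ → ℝ} (hg : IsDensity g) (hh : IsDensity h) :
    Integrable (fun p : ℝ × ℝ => g p.2 * h (p.1 - p.2)) (volume.prod volume) :=
  hg.integrable.convolution_integrand (ContinuousLinearMap.mul ℝ ℝ) hh.integrable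

lemma isDensity_obsDensity (hf : IsDensity (f θ)) (hh : IsDensity h) :
    IsDensity (obsDensity h f θ) where
  measurable := by
    have hm : Measurable fun p : ℝ × ℝ => f θ p.2 * h (p.1 - p.2) :=
      (hf.measurable.comp measurable_snd).mul (hh.measurable.comp (by fun_prop))
    exact (hm.stronglyMeasurable.integral_prod_right (ν := volume)).measurable
  nonneg y := integral_nonneg fun s => mul_nonneg (hf.nonneg s) (hh.nonneg _)
  integrable := (integrable_mixture_integrand hf hh).integral_prod_left
  integral_eq_one := by
    have := integral_convolution (ContinuousLinearMap.mul ℝ ℝ) hf.integrable hh.integrable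
    simpa [convolution, obsDensity, hf.integral_eq_one, hh.integral_eq_one] using this

lemma obsLaw_lawOf (hf : IsDensity (f θ)) (hh : IsDensity h) :
    obsLaw h (lawOf (f θ)) = lawOf (obsDensity h f θ) := by
  have hfm := hf.measurable
  have hhm := hh.measurable
  rw [obsLaw, lawOf, lawOf, lawOf, conv_withDensity_eq_lconvolution (by fun_prop) (by fun_prop)]
  refine withDensity_congr_ae ?_
  -- The Bochner integral defaults to `0` without integrability, which Fubini grants only for almost
  -- every `y`.
  filter_upwards [(integrable_mixture_integrand hf hh).prod_right_ae] with y hy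
  rw [obsDensity, ofReal_integral_eq_lintegral_ofReal hy
    (Eventually.of_forall fun s => mul_nonneg (hf.nonneg s) (hh.nonneg _)), lconvolution_def]
  refine lintegral_congr fun s => ?_
  rw [← ENNReal.ofReal_mul (hf.nonneg s), neg_add_eq_sub]

/-- Lets Lebesgue-a.e. facts on the score pass to every alternative, however singular `F` is. -/
lemma obsLaw_absolutelyContinuous (h : ℝ → ℝ) (F : Measure ℝ) [SFinite (lawOf h)] :
    obsLaw h F ≪ volume :=
  Measure.conv_absolutelyContinuous (lawOf_absolutelyContinuous h)

end Mixture

/-! ### Consequences of regularity -/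

section Regular

variable {k : ℕ} {h : ℝ → ℝ} {Θ : Set (EuclideanSpace ℝ (Fin k))}
  {f : EuclideanSpace ℝ (Fin k) → ℝ → ℝ}

lemma lintegral_sq_score (hR : IsRegular h Θ f) {θ : EuclideanSpace ℝ (Fin k)} (hθ : θ ∈ Θ)
    (i : Fin k) :
    ∫⁻ y, ENNReal.ofReal (score h f θ y i ^ 2) ∂(lawOf (obsDensity h f θ)) =
      ENNReal.ofReal (fisherInfo h f θ i i) := by
  have h2 : MemLp (fun y => score h f θ y i) 2 (lawOf (obsDensity h f θ)) :=
    (hR.memLp_score θ hθ).eval_piLp i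
  rw [← ofReal_integral_eq_lintegral_ofReal h2.integrable_sq
    (Eventually.of_forall fun y => sq_nonneg _)]
  simp [fisherInfo, pow_two]

/-- A smooth path of densities in a regular model with bounded Fisher information, which is defined
on the whole line and starts at `θ = 0` in the direction of a coordinate axis. -/
lemma IsRegular.exists_path (hR : IsRegular h Θ f) (hh : IsDensity h) (i : Fin k) :
    ∃ (δ : ℝ) (C : NNReal) (q q' : ℝ → ℝ → ℝ), 0 < δ ∧ (∀ t, IsDensity (q t)) ∧
      (∀ y t, HasDerivAt (fun t => q t y) (q' t y) t) ∧ (∀ y, Continuous fun t => q' t y) ∧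
      (∀ t, ∫⁻ y, ENNReal.ofReal (q' t y ^ 2 / q t y) ≤ C) ∧
      q 0 =ᵐ[volume] obsDensity h f 0 ∧
      ∀ᵐ y, effScore h f y i = if 0 < q 0 y then δ⁻¹ * (q' 0 y / q 0 y) else 0 := by
  classical
  set e : EuclideanSpace ℝ (Fin k) := EuclideanSpace.single i 1
  have hcurve : Continuous fun u : ℝ => u • e := by fun_prop
  have hI : ContinuousAt (fun u : ℝ => fisherInfo h f (u • e) i i) 0 := by
    have h1 : ContinuousAt (fisherInfo h f) ((0 : ℝ) • e) := by
      rw [zero_smul]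
      exact hR.fisherInfo_continuous.continuousAt (hR.isOpen.mem_nhds hR.zero_mem)
    have h2 : ContinuousAt (fun u : ℝ => fisherInfo h f (u • e)) 0 :=
      ContinuousAt.comp (f := fun u : ℝ => u • e) h1 hcurve.continuousAt
    exact ((continuous_apply_apply i i).continuousAt).comp h2
  have hev : ∀ᶠ u : ℝ in 𝓝 0, u • e ∈ Θ ∧
      fisherInfo h f (u • e) i i < fisherInfo h f ((0 : ℝ) • e) i i + 1 := by
    refine (hcurve.continuousAt.eventually (hR.isOpen.mem_nhds ?_)).and
      (hI.eventually (gt_mem_nhds (lt_add_one _)))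
    simpa using hR.zero_mem
  obtain ⟨ε, hε, hball⟩ := Metric.eventually_nhds_iff.1 hev
  obtain ⟨δ, hδ, hδε⟩ := exists_between hε
  -- The sine confines the path to a small segment for all real `t`, so every hypothesis holds
  -- globally; its velocity at `0` is `δ e`, whence the factor `δ⁻¹` in the score.
  set γ : ℝ → EuclideanSpace ℝ (Fin k) := fun t => (δ * Real.sin t) • e
  have hsmall : ∀ t, dist (δ * Real.sin t) 0 < ε := fun t => by
    rw [dist_zero_right, norm_mul, Real.norm_of_nonneg hδ.le, Real.norm_eq_abs]
    calc δ * |Real.sin t| ≤ δ * 1 := by gcongr; exact Real.abs_sin_le_one t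
      _ < ε := by rwa [mul_one]
  have hγΘ : ∀ t, γ t ∈ Θ := fun t => (hball (hsmall t)).1
  have hγI : ∀ t, fisherInfo h f (γ t) i i ≤ fisherInfo h f ((0 : ℝ) • e) i i + 1 :=
    fun t => (hball (hsmall t)).2.le
  have hγ0 : γ 0 = 0 := by simp [γ]
  have hγd : ∀ t, HasDerivAt γ ((δ * Real.cos t) • e) t := fun t =>
    ((Real.hasDerivAt_sin t).const_mul δ).smul_const e
  -- One measurable null set serves all `t`. With the densities set to `0` on it, differentiability
  -- in `t` holds for every `y`.
  set N : Set ℝ := toMeasurable volume {y | ¬ ContDiffOn ℝ 1 (fun θ => obsDensity h f θ y) Θ}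
  have hNm : MeasurableSet N := measurableSet_toMeasurable _ _
  have hN0 : volume N = 0 := by
    rw [measure_toMeasurable]
    exact hR.contDiff
  have hN : ∀ y, y ∉ N → ContDiffOn ℝ 1 (fun θ => obsDensity h f θ y) Θ := fun y hy => by
    by_contra hcon
    exact hy (subset_toMeasurable _ _ hcon)
  have hNae : ∀ᵐ y, y ∉ N := measure_eq_zero_iff_ae_notMem.1 hN0
  set q : ℝ → ℝ → ℝ := fun t y => if y ∈ N then 0 else obsDensity h f (γ t) y
  set q' : ℝ → ℝ → ℝ := fun t y => if y ∈ N then 0 else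
    (δ * Real.cos t) * fderiv ℝ (fun θ => obsDensity h f θ y) (γ t) e
  have hqae : ∀ t, q t =ᵐ[volume] obsDensity h f (γ t) := fun t => by
    filter_upwards [hNae] with y hy
    simp [q, hy]
  have hden : ∀ t, IsDensity (obsDensity h f (γ t)) := fun t =>
    isDensity_obsDensity (hR.isDensity _ (hγΘ t)) hh
  have hdiff : ∀ y, y ∉ N → ∀ t, DifferentiableAt ℝ (fun θ => obsDensity h f θ y) (γ t) :=
    fun y hy t => ((hN y hy).differentiableOn one_ne_zero).differentiableAt
      (hR.isOpen.mem_nhds (hγΘ t))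
  refine ⟨δ, (δ ^ 2 * (fisherInfo h f ((0 : ℝ) • e) i i + 1)).toNNReal, q, q', hδ, fun t => ?_,
    fun y t => ?_, fun y => ?_, fun t => ?_, hγ0 ▸ hqae 0, ?_⟩
  · refine ⟨Measurable.ite hNm measurable_const (hden t).measurable, fun y => ?_,
      (hden t).integrable.congr (hqae t).symm, ?_⟩
    · simp only [q]
      split_ifs
      exacts [le_rfl, (hden t).nonneg y]
    · rw [integral_congr_ae (hqae t), (hden t).integral_eq_one]
  · by_cases hy : y ∈ N
    · simpa [q, q', hy] using hasDerivAt_const t (0 : ℝ)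
    · simpa [q, q', hy, Function.comp_def] using
        (hdiff y hy t).hasFDerivAt.comp_hasDerivAt t (hγd t)
  · by_cases hy : y ∈ N
    · simpa [q', hy] using continuous_const
    · have h1 := (hN y hy).continuousOn_fderiv_of_isOpen hR.isOpen le_rfl
      have h2 : Continuous fun t => fderiv ℝ (fun θ => obsDensity h f θ y) (γ t) :=
        h1.comp_continuous (by fun_prop) hγΘ
      simp only [q', hy, if_false]
      fun_prop
  · calc ∫⁻ y, ENNReal.ofReal (q' t y ^ 2 / q t y)
        ≤ ∫⁻ y, ENNReal.ofReal (δ ^ 2) * (ENNReal.ofReal (obsDensity h f (γ t) y) *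
            ENNReal.ofReal (score h f (γ t) y i ^ 2)) := by
          refine lintegral_mono_ae ?_
          filter_upwards [hNae] with y hy
          rw [← ENNReal.ofReal_mul ((hden t).nonneg y), ← ENNReal.ofReal_mul (sq_nonneg _)]
          refine ENNReal.ofReal_le_ofReal ?_
          simp only [q, q', hy, if_false, score]
          rcases ((hden t).nonneg y).eq_or_lt with h0 | h0
          · simp [← h0]
          · simp only [h0, if_true]
            rw [mul_pow, mul_pow, div_pow]
            calc _ ≤ δ ^ 2 * 1 * fderiv ℝ (fun θ => obsDensity h f θ y) (γ t) e ^ 2 /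
                  obsDensity h f (γ t) y := by
                  gcongr
                  exact Real.cos_sq_le_one t
              _ = δ ^ 2 * (obsDensity h f (γ t) y *
                  (fderiv ℝ (fun θ => obsDensity h f θ y) (γ t) e ^ 2 /
                    obsDensity h f (γ t) y ^ 2)) := by field_simp
      _ = ENNReal.ofReal (δ ^ 2) * ENNReal.ofReal (fisherInfo h f (γ t) i i) := by
          rw [lintegral_const_mul' _ _ ENNReal.ofReal_ne_top, ← lintegral_sq_score hR (hγΘ t) i,
            lawOf, lintegral_withDensity_eq_lintegral_mul_non_measurable₀]
          · rfl
          · exact (hden t).measurable.ennreal_ofReal.aemeasurable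
          · exact Eventually.of_forall fun y => ENNReal.ofReal_lt_top
      _ ≤ ENNReal.ofReal (δ ^ 2) * ENNReal.ofReal (fisherInfo h f ((0 : ℝ) • e) i i + 1) := by
          gcongr
          exact hγI t
      _ = _ := by rw [← ENNReal.ofReal_mul (sq_nonneg _)]; rfl
  · filter_upwards [hNae] with y hy
    simp only [effScore, score, q, q', hy, if_false, hγ0, Real.cos_zero, mul_one]
    split_ifs with h0
    · simp only [e]
      field_simp
    · rfl

/-- Square integrability gives measurability only up to null sets of the null law, which may miss
part of an alternative. For Lebesgue measure it holds because the derivatives are limits of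
difference quotients along the paths. -/
lemma IsRegular.aemeasurable_effScore (hR : IsRegular h Θ f) (hh : IsDensity h) :
    AEMeasurable (effScore h f) := by
  have h1 : AEMeasurable fun y i => effScore h f y i := by
    refine aemeasurable_pi_lambda _ fun i => ?_
    obtain ⟨δ, C, q, q', -, hden, hd, -, -, -, hs⟩ := hR.exists_path hh i
    refine AEMeasurable.congr (Measurable.aemeasurable ?_) (EventuallyEq.symm hs)
    have hm := fun t => (hden t).measurable
    exact Measurable.ite (measurableSet_lt measurable_const (hm 0))
      (((measurable_of_hasDerivAt hm hd 0).div (hm 0)).const_mul _) measurable_const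
  exact (WithLp.measurable_toLp 2 (Fin k → ℝ)).comp_aemeasurable h1

theorem IsRegular.integral_effScore_eq_zero (hR : IsRegular h Θ f) (hh : IsDensity h)
    (i : Fin k) : ∫ y, effScore h f y i ∂(lawOf (obsDensity h f 0)) = 0 := by
  obtain ⟨δ, C, q, q', -, hden, hd, hc, hC, h0, hs⟩ := hR.exists_path hh i
  rw [← lawOf_congr h0]
  have h1 : (fun y => effScore h f y i) =ᵐ[lawOf (q 0)] fun y => δ⁻¹ * (q' 0 y / q 0 y) := by
    filter_upwards [(lawOf_absolutelyContinuous (q 0)).ae_le hs,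
      ae_pos_lawOf (hden 0).measurable] with y hy hpos
    rw [hy, if_pos hpos]
  rw [integral_congr_ae h1, integral_const_mul,
    integral_score_eq_zero_of_energy_le hden hd hc hC, mul_zero]

/-- The quadratic form at `x` is the second moment of `∑ i, x i * ℓ i`. -/
lemma posSemidef_of_memLp {μ : Measure ℝ} {ℓ : ℝ → EuclideanSpace ℝ (Fin k)}
    (hℓ : MemLp ℓ 2 μ) : (Matrix.of fun i j => ∫ y, ℓ y i * ℓ y j ∂μ).PosSemidef := by
  have hint : ∀ i j, Integrable (fun y => ℓ y i * ℓ y j) μ := fun i j =>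
    (hℓ.eval_piLp i).integrable_mul (hℓ.eval_piLp j)
  refine Matrix.PosSemidef.of_dotProduct_mulVec_nonneg ?_ fun x => ?_
  · ext i j
    simp [mul_comm]
  · have : star x ⬝ᵥ (Matrix.of fun i j => ∫ y, ℓ y i * ℓ y j ∂μ).mulVec x =
        ∫ y, (∑ i, x i * ℓ y i) ^ 2 ∂μ := by
      simp_rw [pow_two, Finset.sum_mul_sum]
      have hint' : ∀ i j, Integrable (fun y => x i * ℓ y i * (x j * ℓ y j)) μ := fun i j => by
        convert (hint i j).const_mul (x i * x j) using 2
        ring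
      rw [integral_finsetSum _ fun i _ => integrable_finsetSum _ fun j _ => hint' i j]
      simp only [dotProduct, Matrix.mulVec, star_trivial, Matrix.of_apply]
      refine Finset.sum_congr rfl fun i _ => ?_
      rw [integral_finsetSum _ fun j _ => hint' i j, Finset.mul_sum]
      refine Finset.sum_congr rfl fun j _ => ?_
      rw [← integral_mul_const, ← integral_const_mul]
      congr 1; ext y; ring
    rw [this]
    exact integral_nonneg fun y => sq_nonneg _

lemma IsRegular.posDef_fisherInfo_zero (hR : IsRegular h Θ f) : (fisherInfo h f 0).PosDef :=
  (posSemidef_of_memLp (hR.memLp_score 0 hR.zero_mem)).posDef_iff_isUnit.2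
    ((Matrix.isUnit_iff_isUnit_det _).2 (hR.fisherInfo_nonsingular 0 hR.zero_mem))

end Regular

/-! ### Scores of nested models -/

section Nested

variable {h f₀ : ℝ → ℝ} {d : ℕ} {Θ : (k : ℕ) → Set (EuclideanSpace ℝ (Fin k))}
  {f : (k : ℕ) → EuclideanSpace ℝ (Fin k) → ℝ → ℝ}

lemma hasFDerivAt_pad (k m : ℕ) (θ : EuclideanSpace ℝ (Fin k)) :
    ∃ L : EuclideanSpace ℝ (Fin k) →L[ℝ] EuclideanSpace ℝ (Fin m),
      (∀ v, L v = pad k m v) ∧ HasFDerivAt (pad k m) L θ := by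
  let L : EuclideanSpace ℝ (Fin k) →ₗ[ℝ] EuclideanSpace ℝ (Fin m) :=
    { toFun := pad k m
      map_add' := fun x y => by ext i; simp only [pad, PiLp.add_apply]; split_ifs <;> simp
      map_smul' := fun c x => by ext i; simp [pad] }
  exact ⟨LinearMap.toContinuousLinearMap L, fun v => rfl,
    (LinearMap.toContinuousLinearMap L).hasFDerivAt⟩

lemma pad_single {k m : ℕ} (hkm : k ≤ m) (i : Fin k) :
    pad k m (EuclideanSpace.single i 1) = EuclideanSpace.single (Fin.castLE hkm i) 1 := by
  ext j
  by_cases hj : (j : ℕ) < k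
  · simp [pad, hj, Fin.ext_iff]
  · have : (j : ℕ) ≠ i := fun hji => hj (hji ▸ i.2)
    simp [pad, hj, Fin.ext_iff, this]

/-- The score vector of a smaller model is an initial segment of that of a larger one. -/
theorem IsNestedRegularFamily.effScore_ae_eq (hf : IsNestedRegularFamily h f₀ d Θ f) {k m : ℕ}
    (hk : 1 ≤ k) (hkm : k ≤ m) (hm : m ≤ d) :
    ∀ᵐ y, ∀ i : Fin k, effScore h (f k) y i = effScore h (f m) y (Fin.castLE hkm i) := by
  have hRk := hf.regular k hk (hkm.trans hm)
  have hRm := hf.regular m (hk.trans hkm) hm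
  have heq : ∀ θ ∈ Θ k, ∀ y, obsDensity h (f k) θ y = obsDensity h (f m) (pad k m θ) y :=
    -- The families agree only a.e. in `s`, but integration makes the mixtures agree at every `y`.
    fun θ hθ y => integral_congr_ae <| by
      filter_upwards [(hf.nested k m hk hkm hm θ hθ).2] with s hs
      rw [hs]
  obtain ⟨L, hL, hLd⟩ := hasFDerivAt_pad k m 0
  have hp0 : pad k m 0 = 0 := by rw [← hL, map_zero]
  filter_upwards [hRm.contDiff] with y hy i
  have h0 : obsDensity h (f k) 0 y = obsDensity h (f m) 0 y := by
    rw [heq 0 hRk.zero_mem, hp0]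
  have hd : HasFDerivAt (fun θ => obsDensity h (f m) θ y)
      (fderiv ℝ (fun θ => obsDensity h (f m) θ y) 0) (pad k m 0) := by
    rw [hp0]
    exact ((hy.differentiableOn one_ne_zero).differentiableAt
      (hRm.isOpen.mem_nhds hRm.zero_mem)).hasFDerivAt
  have hfd : fderiv ℝ (fun θ => obsDensity h (f k) θ y) 0 =
      (fderiv ℝ (fun θ => obsDensity h (f m) θ y) 0).comp L := by
    refine HasFDerivAt.fderiv ((hd.comp 0 hLd).congr_of_eventuallyEq ?_)
    filter_upwards [hRk.isOpen.mem_nhds hRk.zero_mem] with θ hθ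
    exact heq θ hθ y
  simp only [effScore, score, h0, hfd]
  split_ifs
  · simp [hL, pad_single hkm]
  · rfl

end Nested

/-! ### Level and power of the tests -/

section Consistency

variable {h f₀ : ℝ → ℝ} {d : ℕ} {Θ : (k : ℕ) → Set (EuclideanSpace ℝ (Fin k))}
  {f : (k : ℕ) → EuclideanSpace ℝ (Fin k) → ℝ → ℝ}

/-- The weight matrix is, by unfolding, the inverse Fisher information at `0`. -/
lemma scoreStat_eq (h : ℝ → ℝ) {k : ℕ} (f : EuclideanSpace ℝ (Fin k) → ℝ → ℝ) :
    scoreStat h f = fun n Y => quadForm (fisherInfo h f 0)⁻¹ (normSum (effScore h f) n Y) := by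
  ext n Y
  exact scoreStat_eq_quadForm h f n Y

lemma scoreStat_nonneg {k : ℕ} {Θ : Set (EuclideanSpace ℝ (Fin k))}
    {f : EuclideanSpace ℝ (Fin k) → ℝ → ℝ} (hR : IsRegular h Θ f) (n : ℕ) (Y : Fin n → ℝ) :
    0 ≤ scoreStat h f n Y := by
  rw [scoreStat_eq]
  exact quadForm_nonneg hR.posDef_fisherInfo_zero.posSemidef.inv _

/-- The score statistic is asymptotically chi-squared under the null hypothesis. -/
theorem tendsto_rejectProb_null (hh : IsDensity h) (hf₀ : IsDensity f₀)
    (hf : IsNestedRegularFamily h f₀ d Θ f) {k : ℕ} (hk : 1 ≤ k) (hkd : k ≤ d) (c : ℝ) :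
    Tendsto (rejectProb h (lawOf f₀) (scoreStat h (f k)) c) atTop
      (𝓝 ((chiSquared k).real (Set.Ioi c))) := by
  have hR := hf.regular k hk hkd
  have := isProbabilityMeasure_lawOf hh
  have := isProbabilityMeasure_lawOf hf₀
  have hlaw : obsLaw h (lawOf f₀) = lawOf (obsDensity h (f k) 0) := by
    rw [← lawOf_congr (hf.null k hk hkd), obsLaw_lawOf (hR.isDensity 0 hR.zero_mem) hh]
  rw [scoreStat_eq]
  refine tendsto_rejectProb_chiSquared hk hR.posDef_fisherInfo_zero ?_ (fun i => ?_)
    (fun i j => ?_) c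
  · rw [hlaw]
    exact hR.memLp_score 0 hR.zero_mem
  · rw [hlaw]
    exact hR.integral_effScore_eq_zero hh i
  · rw [hlaw]
    rfl

/-- Under ⟨D1⟩ with `K ≤ k` the score statistic `U_k` exceeds every sequence that is `o(n)`. -/
theorem tendsto_measure_scoreStat_gt (hh : IsDensity h)
    (hf : IsNestedRegularFamily h f₀ d Θ f) {k : ℕ} (hk : 1 ≤ k) (hkd : k ≤ d)
    {F : Measure ℝ} [IsProbabilityMeasure F] {K : ℕ} (hF : CondD1 h (f d) F K) (hKk : K ≤ k)
    {M : ℕ → ℝ} (hM : M =o[atTop] fun n : ℕ => (n : ℝ)) :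
    Tendsto (fun n => (sampleMeasure h F n).real {ω | M n < scoreStat h (f k) n (obs ω)}) atTop
      (𝓝 1) := by
  have hR := hf.regular k hk hkd
  have := isProbabilityMeasure_lawOf hh
  obtain ⟨hK1, hKd, -, hK⟩ := hF
  have hac := obsLaw_absolutelyContinuous h F
  set i : Fin k := ⟨K - 1, by omega⟩
  have hi : ((Fin.castLE hkd i : Fin d) : ℕ) + 1 = K := by simp [i]; omega
  obtain ⟨hint, hmean⟩ := hK _ hi
  have hae : (fun y => effScore h (f k) y i) =ᵐ[obsLaw h F]
      fun y => effScore h (f d) y (Fin.castLE hkd i) := by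
    filter_upwards [hac.ae_le (hf.effScore_ae_eq hk hkd le_rfl)] with y hy using hy i
  rw [scoreStat_eq]
  refine tendsto_measure_gt_of_mean_ne_zero hR.posDef_fisherInfo_zero
    ((hR.aemeasurable_effScore hh).mono_ac hac) i (hint.congr hae.symm) ?_ hM
  rwa [integral_congr_ae hae]

/-- The power of the test based on `U_k` does not tend to `1` if the first `k` components of the
score are centred and square integrable under the alternative. -/
theorem isInconsistentAgainst_scoreStat (hh : IsDensity h)
    (hf : IsNestedRegularFamily h f₀ d Θ f) {k : ℕ} (hk : 1 ≤ k) (hkd : k ≤ d)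
    {F : Measure ℝ} [IsProbabilityMeasure F] {K : ℕ} (hF : CondD1 h (f d) F K) (hkK : k < K)
    (hL2 : ∀ i : Fin d, (i : ℕ) + 1 ≤ k →
      MemLp (fun y => effScore h (f d) y i) 2 (obsLaw h F)) :
    IsInconsistentAgainst h (scoreStat h (f k)) k F := by
  intro α h0 h1
  have := isProbabilityMeasure_lawOf hh
  have hac := obsLaw_absolutelyContinuous h F
  have hae : ∀ i : Fin k, (fun y => effScore h (f k) y i) =ᵐ[obsLaw h F]
      fun y => effScore h (f d) y (Fin.castLE hkd i) := fun i => by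
    filter_upwards [hac.ae_le (hf.effScore_ae_eq hk hkd le_rfl)] with y hy using hy i
  have hi : ∀ i : Fin k, ((Fin.castLE hkd i : Fin d) : ℕ) + 1 ≤ k := fun i => i.2
  have hℓ : MemLp (effScore h (f k)) 2 (obsLaw h F) :=
    MemLp.of_eval_piLp fun i => (memLp_congr_ae (hae i)).2 (hL2 _ (hi i))
  rw [scoreStat_eq]
  -- The covariance is taken under `F`, may be singular, and need not match the weight matrix of the
  -- null law.
  refine not_tendsto_rejectProb_one (posSemidef_of_memLp hℓ) hℓ (fun i => ?_) (fun i j => rfl) _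
    (criticalPoint_pos hk h0 h1)
  rw [integral_congr_ae (hae i)]
  exact (hF.2.2.1 _ ((hi i).trans_lt hkK)).2

/-- A finite nonempty range has a maximizer, so the `sInf` is not the default `0` of the empty set.
-/
lemma selection_mem (h : ℝ → ℝ) (f : (k : ℕ) → EuclideanSpace ℝ (Fin k) → ℝ → ℝ) (hd : 1 ≤ d)
    (pen : ℕ → ℕ → ℝ) (n : ℕ) (Y : Fin n → ℝ) :
    1 ≤ selection h f d pen n Y ∧ selection h f d pen n Y ≤ d ∧ ∀ j, 1 ≤ j → j ≤ d →
      scoreStat h (f j) n Y - pen j n ≤ scoreStat h (f (selection h f d pen n Y)) n Y -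
        pen (selection h f d pen n Y) n := by
  obtain ⟨k, hk, hmax⟩ := (Finset.Icc 1 d).exists_max_image
    (fun k => scoreStat h (f k) n Y - pen k n) ⟨1, Finset.mem_Icc.2 ⟨le_rfl, hd⟩⟩
  rw [Finset.mem_Icc] at hk
  have hne : {k | 1 ≤ k ∧ k ≤ d ∧ ∀ j, 1 ≤ j → j ≤ d →
      scoreStat h (f j) n Y - pen j n ≤ scoreStat h (f k) n Y - pen k n}.Nonempty :=
    ⟨k, hk.1, hk.2, fun j h1 h2 => hmax j (Finset.mem_Icc.2 ⟨h1, h2⟩)⟩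
  exact Nat.sInf_mem hne

/-- The data-driven test has asymptotic level `α`. -/
theorem tendsto_rejectProb_dataDrivenStat_null (hh : IsDensity h) (hf₀ : IsDensity f₀)
    (hf : IsNestedRegularFamily h f₀ d Θ f) (hd : 1 ≤ d) {pen : ℕ → ℕ → ℝ} (hp : IsPenalty d pen)
    (c : ℝ) :
    Tendsto (rejectProb h (lawOf f₀) (dataDrivenStat h f d pen) c) atTop
      (𝓝 ((chiSquared 1).real (Set.Ioi c))) := by
  have := isProbabilityMeasure_lawOf hh
  have := isProbabilityMeasure_lawOf hf₀
  set P := sampleMeasure h (lawOf f₀)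
  have : ∀ n, IsProbabilityMeasure (P n) := fun n => by infer_instance
  set A : ℕ → ℕ → ℝ := fun j n => (P n).real
    {ω | pen j n - pen 1 n < scoreStat h (f j) n (obs ω)}
  have hA : ∀ j ∈ Finset.Icc 2 d, Tendsto (A j) atTop (𝓝 0) := fun j hj => by
    rw [Finset.mem_Icc] at hj
    refine tendsto_order.2 ⟨fun a ha => Eventually.of_forall fun n =>
      ha.trans_le measureReal_nonneg, fun a ha => ?_⟩
    -- Tightness: the limit law gives `(b, ∞)` mass below `a`, and the penalty gap eventually passes
    -- `b`.
    obtain ⟨b, hb⟩ := ((tendsto_chiSquared_Ioi j).eventually (gt_mem_nhds ha)).exists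
    filter_upwards [(tendsto_rejectProb_null hh hf₀ hf (by omega) hj.2 b).eventually
      (gt_mem_nhds hb), (hp.tendsto j hj.1 hj.2).eventually_ge_atTop b] with n hn1 hn2
    refine lt_of_le_of_lt (measureReal_mono fun ω hω => ?_) hn1
    exact hn2.trans_lt hω
  have hsum : Tendsto (fun n => ∑ j ∈ Finset.Icc 2 d, A j n) atTop (𝓝 0) := by
    simpa using tendsto_finsetSum _ hA
  have hone := tendsto_rejectProb_null hh hf₀ hf le_rfl hd c
  have hsel : ∀ n, (P n).real {ω | selection h f d pen n (obs ω) ≠ 1} ≤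
      ∑ j ∈ Finset.Icc 2 d, A j n := fun n => by
    refine (measureReal_mono (fun ω hω => ?_) (measure_ne_top (P n) _)).trans
      (measureReal_biUnion_finset_le (Finset.Icc 2 d) _)
    obtain ⟨hs1, hsd, hs⟩ := selection_mem h f hd pen n (obs ω)
    have hs2 : 2 ≤ selection h f d pen n (obs ω) := by
      have : selection h f d pen n (obs ω) ≠ 1 := hω
      omega
    by_contra hcon
    simp only [Set.mem_iUnion, not_exists] at hcon
    have h1 : scoreStat h (f (selection h f d pen n (obs ω))) n (obs ω) ≤
        pen (selection h f d pen n (obs ω)) n - pen 1 n :=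
      not_lt.1 (hcon _ (Finset.mem_Icc.2 ⟨hs2, hsd⟩))
    -- If `U_S` does not exceed its gap, then `U_S - π(S, n) ≤ -π(1, n) ≤ U_1 - π(1, n)`, so `1` is
    -- also a maximizer, against the minimality of `S ≥ 2`.
    have hmem : 1 ∈ {k | 1 ≤ k ∧ k ≤ d ∧ ∀ j, 1 ≤ j → j ≤ d →
        scoreStat h (f j) n (obs ω) - pen j n ≤ scoreStat h (f k) n (obs ω) - pen k n} := by
      refine ⟨le_rfl, hd, fun j hj1 hjd => (hs j hj1 hjd).trans ?_⟩
      have := scoreStat_nonneg (hf.regular 1 le_rfl hd) n (obs ω)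
      linarith
    have : selection h f d pen n (obs ω) ≤ 1 := Nat.sInf_le hmem
    omega
  have hup : ∀ n, rejectProb h (lawOf f₀) (dataDrivenStat h f d pen) c n ≤
      rejectProb h (lawOf f₀) (scoreStat h (f 1)) c n + ∑ j ∈ Finset.Icc 2 d, A j n := fun n => by
    refine le_trans ?_ (add_le_add le_rfl (hsel n))
    refine (measureReal_mono fun ω hω => ?_).trans (measureReal_union_le _ _)
    by_cases h1 : selection h f d pen n (obs ω) = 1
    · left
      have : c < scoreStat h (f (selection h f d pen n (obs ω))) n (obs ω) := hω
      rwa [h1] at this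
    · exact Or.inr h1
  have hlow : ∀ n, rejectProb h (lawOf f₀) (scoreStat h (f 1)) c n -
      ∑ j ∈ Finset.Icc 2 d, A j n ≤ rejectProb h (lawOf f₀) (dataDrivenStat h f d pen) c n :=
    fun n => by
    rw [sub_le_iff_le_add]
    refine le_trans ?_ (add_le_add le_rfl (hsel n))
    refine (measureReal_mono fun ω hω => ?_).trans (measureReal_union_le _ _)
    by_cases h1 : selection h f d pen n (obs ω) = 1
    · left
      change c < scoreStat h (f (selection h f d pen n (obs ω))) n (obs ω)
      rwa [h1]
    · exact Or.inr h1
  exact tendsto_of_tendsto_of_tendsto_of_le_of_le (by simpa using hone.sub hsum)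
    (by simpa using hone.add hsum) hlow hup

/-- The power of the data-driven test tends to `1` under ⟨D1⟩. -/
theorem tendsto_rejectProb_dataDrivenStat_one (hh : IsDensity h)
    (hf : IsNestedRegularFamily h f₀ d Θ f) {pen : ℕ → ℕ → ℝ} (hp : CondS1 d pen)
    {F : Measure ℝ} [IsProbabilityMeasure F] {K : ℕ} (hF : CondD1 h (f d) F K) (c : ℝ) :
    Tendsto (rejectProb h F (dataDrivenStat h f d pen) c) atTop (𝓝 1) := by
  have := isProbabilityMeasure_lawOf hh
  obtain ⟨hK1, hKd, -⟩ := id hF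
  -- A threshold for `U_K` that forces `U_S > c`; the sum over all dimensions dominates the penalty
  -- at the random index `S`.
  have hM : (fun n => ‖c‖ + ‖pen K n‖ + ∑ j ∈ Finset.Icc 1 d, ‖pen j n‖) =o[atTop]
      fun n : ℕ => (n : ℝ) := by
    refine (Asymptotics.IsLittleO.add ?_ (hp K hK1 hKd).norm_left).add
      (Asymptotics.IsLittleO.fun_sum fun j hj => ?_)
    · exact (Asymptotics.isLittleO_const_id_atTop ‖c‖).comp_tendsto tendsto_natCast_atTop_atTop
    · rw [Finset.mem_Icc] at hj
      exact (hp j hj.1 hj.2).norm_left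
  refine tendsto_of_tendsto_of_tendsto_of_le_of_le
    (tendsto_measure_scoreStat_gt hh hf hK1 hKd hF le_rfl hM) tendsto_const_nhds
    (fun n => measureReal_mono fun ω hω => ?_) fun n => measureReal_le_one
  obtain ⟨hs1, hsd, hs⟩ := selection_mem h f (hK1.trans hKd) pen n (obs ω)
  have h1 := hs K hK1 hKd
  have h2 : ‖pen (selection h f d pen n (obs ω)) n‖ ≤ ∑ j ∈ Finset.Icc 1 d, ‖pen j n‖ :=
    Finset.single_le_sum (f := fun j => ‖pen j n‖) (fun j _ => norm_nonneg _)
      (Finset.mem_Icc.2 ⟨hs1, hsd⟩)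
  have h3 : ‖c‖ + ‖pen K n‖ + ∑ j ∈ Finset.Icc 1 d, ‖pen j n‖ < scoreStat h (f K) n (obs ω) := hω
  have h4 := Real.le_norm_self c
  have h5 := Real.le_norm_self (pen K n)
  have h6 : -‖pen (selection h f d pen n (obs ω)) n‖ ≤ _ := neg_abs_le (pen (selection h f d pen n (obs ω)) n)
  change c < scoreStat h (f (selection h f d pen n (obs ω))) n (obs ω)
  linarith

end Consistency

end Deconvolution

/-! ### The main theorem -/

open Deconvolution in
theorem mainTheorem1 (h f₀ : ℝ → ℝ) (hh : IsNoiseDensity h) (hf₀ : IsDensity f₀) (d : ℕ)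
    (Θ : (k : ℕ) → Set (EuclideanSpace ℝ (Fin k)))
    (f : (k : ℕ) → EuclideanSpace ℝ (Fin k) → ℝ → ℝ)
    (hf : IsNestedRegularFamily h f₀ d Θ f) :
    (∀ k : ℕ, 1 ≤ k → k ≤ d → ∀ (F : Measure ℝ) [IsProbabilityMeasure F] (K : ℕ),
      CondD1 h (f d) F K → K ≤ k →
        IsConsistentAgainst h f₀ (scoreStat h (f k)) k F) ∧
    (∀ k : ℕ, 1 ≤ k → k ≤ d → ∀ (F : Measure ℝ) [IsProbabilityMeasure F] (K : ℕ),
      CondD1 h (f d) F K → k < K →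
        (∀ i : Fin d, (i : ℕ) + 1 ≤ k → MemLp (fun y => effScore h (f d) y i) 2 (obsLaw h F)) →
          IsInconsistentAgainst h (scoreStat h (f k)) k F) ∧
    (∀ pen : ℕ → ℕ → ℝ, IsPenalty d pen → CondS1 d pen →
      ∀ (F : Measure ℝ) [IsProbabilityMeasure F] (K : ℕ),
        CondD1 h (f d) F K →
          IsConsistentAgainst h f₀ (dataDrivenStat h f d pen) 1 F) := by
  have hh' := hh.toIsDensity
  refine ⟨fun k hk hkd F _ K hF hKk α h0 h1 => ⟨?_, ?_⟩,
    fun k hk hkd F _ K hF hkK hL2 => isInconsistentAgainst_scoreStat hh' hf hk hkd hF hkK hL2,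
    fun pen hp hS F _ K hF α h0 h1 => ⟨?_, ?_⟩⟩
  · simpa [chiSquared_Ioi_criticalPoint hk h0 h1] using
      tendsto_rejectProb_null hh' hf₀ hf hk hkd (criticalPoint k α)
  · exact tendsto_measure_scoreStat_gt hh' hf hk hkd hF hKk
      ((Asymptotics.isLittleO_const_id_atTop _).comp_tendsto tendsto_natCast_atTop_atTop)
  · simpa [chiSquared_Ioi_criticalPoint le_rfl h0 h1] using
      tendsto_rejectProb_dataDrivenStat_null hh' hf₀ hf (hF.1.trans hF.2.1) hp (criticalPoint 1 α)
  · exact tendsto_rejectProb_dataDrivenStat_one hh' hf hS hF _
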